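/- Let $A\in\mathbb{R}^{n\times n}$, $C\in\mathbb{R}^{m\times n}$, let $Q\in\mathbb{R}^{n\times n}$ be symmetric positive semidefinite and $R\in\mathbb{R}^{m\times m}$ symmetric positive definite, and let $0<p_l<1$, $0<q_l<1$ for $l=1,\dots,m$ (failure and recovery rates of $m$ independent two-state Markovian packet-drop channels). Put $$P_l=\begin{bmatrix}1-q_l&q_l\\ p_l&1-p_l\end{bmatrix},\qquad \pi_l=\Big[\tfrac{p_l}{p_l+q_l}\ \ \tfrac{q_l}{p_l+q_l}\Big],\qquad N=2^m .$$ A mode $i\in\{1,\dots,N\}$ encodes arrival indicators $\gamma_1,\dots,\gamma_m\in\{0,1\}$ through $i=1+\sum_{l=1}^m 2^{l-1}\gamma_l$, and $H_i=\mathrm{diag}\{\gamma_1,\dots,\gamma_m\}\,C$. The mode chain has transition matrix $[p_{ij}]=P_m\otimes\cdots\otimes P_1$ and stationary distribution $\mu=[\mu_1\ \cdots\ \mu_N]=\pi_m\otimes\cdots\otimes\pi_1$. For $L=(L_1,\dots,L_N)$ with $L_i\in\mathbb{R}^{n\times m}$, let $\widetilde{\mathcal L}$ be the operator on $N$-tuples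 of real $n\times n$ matrices given by $\widetilde{\mathcal L}_j(V)=\sum_{i=1}^N p_{ij}(A+L_iH_i)V_i(A+L_iH_i)'$, and let $\rho$ denote the spectral radius (largest modulus of a complex eigenvalue). The jump system $(\mathbf H,\mathbf A,\mathbf p)$ is mean-square (MS) detectable if $\rho(\widetilde{\mathcal L})<1$ for some $L$. The filtering coupled algebraic Riccati equations (CAREs) are $$Y_j=\sum_{i=1}^N p_{ij}\big[AY_iA'-AY_iH_i'(H_iY_iH_i'+\mu_iR)^{-1}H_iY_iA'+\mu_iQ\big],\qquad j=1,\dots,N.$$ A tuple $Y=(Y_1,\dots,Y_N)$ of symmetric positive semidefinite matrices that solves the CAREs is an MS stabilizing solution if $\rho(\widetilde{\mathcal L})<1$ for $L_i=-AY_iH_i'(H_iY_iH_i'+\mu_iR)^{-1}$, $i=1,\dots,N$. Theorem. The CAREs have an MS stabilizing solution if and only if 1) $(\mathbf H,\mathbf A,\mathbf p)$ is MS detectable, and 2) $(A,Q)$ has no uncontrollable eigenvalue on the unit circle, i.e. $\mathrm{rank}\,[\lambda I_n-A\ \ Q]=n$ for all $\lambda\in\mathbb{C}$ with $|\lambda|=1$.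 -/

import Mathlib

open scoped Matrix TensorProduct ENNReal

noncomputable section

namespace JumpFilter

/-- The arrival indicators `(γ₁, …, γₘ)` of a mode. Modes are numbered from `0` to `2 ^ m - 1` by
`θ = ∑ l, γ l * 2 ^ l`, that is, `γ` lists the binary digits of `θ`. -/
def arrival {m : ℕ} (θ : Fin (2 ^ m)) : Fin m → Fin 2 :=
  finFunctionFinEquiv.symm θ

/-- Transition matrix of a single packet-drop channel with failure rate `p` and recovery rate `q`;
state `0` is "dropped" and state `1` is "received". -/
def channelTPM (p q : ℝ) : Matrix (Fin 2) (Fin 2) ℝ :=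
  !![1 - q, q; p, 1 - p]

/-- Limit distribution of a single packet-drop channel. -/
def channelDist (p q : ℝ) : Fin 2 → ℝ :=
  ![p / (p + q), q / (p + q)]

/-- Transition matrix `P = Pₘ ⊗ ⋯ ⊗ P₁` of the mode chain: the `m` channels evolve
independently. -/
def modeTPM {m : ℕ} (p q : Fin m → ℝ) : Matrix (Fin (2 ^ m)) (Fin (2 ^ m)) ℝ :=
  Matrix.of fun i j => ∏ l, channelTPM (p l) (q l) (arrival i l) (arrival j l)

/-- Stationary distribution `μ = πₘ ⊗ ⋯ ⊗ π₁` of the mode chain. -/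
def modeDist {m : ℕ} (p q : Fin m → ℝ) : Fin (2 ^ m) → ℝ :=
  fun i => ∏ l, channelDist (p l) (q l) (arrival i l)

/-- The output matrix `H_θ = Γ C`, `Γ = diag(γ₁, …, γₘ)`, of a mode. -/
def modeOutput {m n : ℕ} (C : Matrix (Fin m) (Fin n) ℝ) (θ : Fin (2 ^ m)) :
    Matrix (Fin m) (Fin n) ℝ :=
  Matrix.diagonal (fun l => ((arrival θ l : ℕ) : ℝ)) * C

/-- The spectral radius of an operator on a real vector space: the supremum of the moduli of the
complex spectrum, i.e. of the spectrum of the complexification. -/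
def spectralRad {E : Type*} [AddCommGroup E] [Module ℝ E] (T : E →ₗ[ℝ] E) : ℝ≥0∞ :=
  spectralRadius ℂ (A := Module.End ℂ (ℂ ⊗[ℝ] E)) (LinearMap.baseChange ℂ T)

/-- The operator `V ↦ (∑ i, P i j • F i * V i * (F i)ᵀ)_j` on tuples of real matrices. -/
def jumpOperator {ι : Type*} [Fintype ι] {n : ℕ} (P : Matrix ι ι ℝ)
    (F : ι → Matrix (Fin n) (Fin n) ℝ) :
    (ι → Matrix (Fin n) (Fin n) ℝ) →ₗ[ℝ] (ι → Matrix (Fin n) (Fin n) ℝ) where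
  toFun V j := ∑ i, P i j • (F i * V i * (F i)ᵀ)
  map_add' V W := by
    funext j
    simp [mul_add, add_mul, Finset.sum_add_distrib]
  map_smul' c V := by
    funext j
    simp [Finset.smul_sum, smul_comm c]

/-- Mean-square detectability of the jump system `(H, A, P)`. -/
def IsMSDetectable {ι : Type*} [Fintype ι] {m n : ℕ} (H : ι → Matrix (Fin m) (Fin n) ℝ)
    (A : ι → Matrix (Fin n) (Fin n) ℝ) (P : Matrix ι ι ℝ) : Prop :=
  ∃ L : ι → Matrix (Fin n) (Fin m) ℝ, spectralRad (jumpOperator P fun i => A i + L i * H i) < 1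

/-- The gains `K_i(Y) = A Y_i H_iᵀ (H_i Y_i H_iᵀ + μ_i R)⁻¹`. -/
def gain {ι : Type*} {m n : ℕ} (A : Matrix (Fin n) (Fin n) ℝ)
    (H : ι → Matrix (Fin m) (Fin n) ℝ) (R : Matrix (Fin m) (Fin m) ℝ) (μ : ι → ℝ)
    (Y : ι → Matrix (Fin n) (Fin n) ℝ) (i : ι) : Matrix (Fin n) (Fin m) ℝ :=
  A * Y i * (H i)ᵀ * (H i * Y i * (H i)ᵀ + μ i • R)⁻¹

/-- `Y` solves the filtering coupled algebraic Riccati equations. -/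
def SolvesCARE {ι : Type*} [Fintype ι] {m n : ℕ} (A : Matrix (Fin n) (Fin n) ℝ)
    (H : ι → Matrix (Fin m) (Fin n) ℝ) (Q : Matrix (Fin n) (Fin n) ℝ)
    (R : Matrix (Fin m) (Fin m) ℝ) (P : Matrix ι ι ℝ) (μ : ι → ℝ)
    (Y : ι → Matrix (Fin n) (Fin n) ℝ) : Prop :=
  ∀ j, Y j = ∑ i, P i j •
    (A * Y i * Aᵀ
      - A * Y i * (H i)ᵀ * (H i * Y i * (H i)ᵀ + μ i • R)⁻¹ * (H i * Y i * Aᵀ)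
      + μ i • Q)

/-- `Y` is a mean-square stabilizing solution of the filtering coupled algebraic Riccati
equations: a tuple of positive semidefinite matrices that solves them and whose gains make the
error operator stable. -/
structure IsMSStabilizingSolution {ι : Type*} [Fintype ι] {m n : ℕ}
    (A : Matrix (Fin n) (Fin n) ℝ) (H : ι → Matrix (Fin m) (Fin n) ℝ)
    (Q : Matrix (Fin n) (Fin n) ℝ) (R : Matrix (Fin m) (Fin m) ℝ) (P : Matrix ι ι ℝ)
    (μ : ι → ℝ) (Y : ι → Matrix (Fin n) (Fin n) ℝ) : Prop where
  posSemidef : ∀ i, (Y i).PosSemidef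
  solves : SolvesCARE A H Q R P μ Y
  stable : spectralRad (jumpOperator P fun i => A + (-gain A H R μ Y i) * H i) < 1

end JumpFilter

end

/-! Stability is used throughout in the form "the powers of the jump operator tend to zero"
(`spectralRad_lt_one_iff`), and instability is detected by positive semidefinite fixed points of the
trace adjoint. Condition 2 is recast accordingly: it fails exactly when some nonzero S ≥ 0 satisfies
AᵀSA = S and SQ = 0 (`forall_rank_fromCols_iff_posSemidef`).

Necessity. The stabilizing gains witness detectability. Given S as above, take traces of the CAREs
against S and sum over the modes: the terms tr(S Y_i) cancel, which leaves a vanishing sum of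
nonnegative terms and forces S K_i = 0. The constant tuple S is then fixed by the adjoint of the
stable error operator, so S = 0 (`jumpAdjoint_eq_of_invariant`, `eq_zero_of_jumpAdjoint_eq`).

Sufficiency. Policy iteration starts from detecting gains: solve the Lyapunov equation for the error
covariance, pass to its Kalman gains, repeat. Stage k uses the noise Q + I/(k+1), whose definite
part keeps every stage stable. The covariances decrease, and their limit solves the CAREs with an
error operator that is a limit of stable ones (`exists_solvesCARE`). By compactness this operator is
stable or its adjoint has a nonzero fixed point U ≥ 0 (`powersVanish_or_exists_jumpAdjoint_eq`). In
the second case, pairing U with the CAREs gives U_j L_i = 0 and U_j Q = 0, so S = ∑ μ_i U_i violates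
condition 2 (`exists_invariant_of_jumpAdjoint_eq`). -/

noncomputable section

namespace JumpFilter

open Filter Topology

/-! ### Spectral radius and vanishing powers. -/

open scoped Matrix.Norms.Operator in
/-- The powers of a complex matrix of spectral radius below one tend to zero. -/
lemma tendsto_pow_of_spectralRadius_lt_one {κ : Type*} [Fintype κ] [DecidableEq κ]
    {M : Matrix κ κ ℂ} (h : spectralRadius ℂ M < 1) (i j : κ) :
    Tendsto (fun k : ℕ => (M ^ k) i j) atTop (𝓝 0) := by
  obtain ⟨r, hr, hr1⟩ := exists_between h
  have hg := spectrum.pow_nnnorm_pow_one_div_tendsto_nhds_spectralRadius M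
  have hev : ∀ᶠ k : ℕ in atTop, (‖M ^ k‖₊ : ℝ≥0∞) ≤ r ^ k := by
    filter_upwards [hg.eventually_lt_const hr, eventually_gt_atTop 0] with k hk hk0
    have h2 := pow_le_pow_left' hk.le k
    rwa [← ENNReal.rpow_natCast, ← ENNReal.rpow_mul, one_div,
      inv_mul_cancel₀ (by exact_mod_cast hk0.ne'), ENNReal.rpow_one] at h2
  have h0 : Tendsto (fun k : ℕ => (‖M ^ k‖₊ : ℝ≥0∞)) atTop (𝓝 0) :=
    tendsto_of_tendsto_of_tendsto_of_le_of_le' tendsto_const_nhds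
      (ENNReal.tendsto_pow_atTop_nhds_zero_of_lt_one hr1) (Eventually.of_forall fun _ => zero_le) hev
  have h1 : Tendsto (fun k : ℕ => ‖M ^ k‖₊) atTop (𝓝 0) := ENNReal.tendsto_coe.1 h0
  have h2 : Tendsto (fun k : ℕ => M ^ k) atTop (𝓝 0) :=
    tendsto_zero_iff_norm_tendsto_zero.2 (by simpa using NNReal.tendsto_coe.2 h1)
  have hc : Continuous (Matrix.entryLinearMap ℂ ℂ i j) :=
    LinearMap.continuous_of_finiteDimensional _
  simpa [Function.comp_def] using (hc.tendsto 0).comp h2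

open scoped Matrix.Norms.Operator in
/-- A complex matrix whose powers tend to zero has spectral radius below one. -/
lemma spectralRadius_lt_one_of_tendsto_pow {κ : Type*} [Fintype κ] [DecidableEq κ]
    {M : Matrix κ κ ℂ} (h : ∀ i j, Tendsto (fun k : ℕ => (M ^ k) i j) atTop (𝓝 0)) :
    spectralRadius ℂ M < 1 := by
  rcases (spectrum ℂ M).eq_empty_or_nonempty with he | hne
  · simp [spectralRadius, he]
  refine spectrum.spectralRadius_lt_of_forall_lt_of_nonempty (r := 1) hne fun z hz => ?_
  rw [← Matrix.spectrum_toLin', ← Module.End.hasEigenvalue_iff_mem_spectrum] at hz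
  obtain ⟨v, hv⟩ := hz.exists_hasEigenvector
  have hp (k : ℕ) : M ^ k *ᵥ v = z ^ k • v := by
    have := hv.pow_apply k
    rwa [← Matrix.toLin'_pow, Matrix.toLin'_apply] at this
  obtain ⟨a, ha⟩ := Function.ne_iff.1 hv.2
  have hta : Tendsto (fun k : ℕ => z ^ k * v a) atTop (𝓝 0) := by
    have h1 : Tendsto (fun k : ℕ => (M ^ k *ᵥ v) a) atTop (𝓝 (∑ b, 0 * v b)) :=
      tendsto_finsetSum _ fun b _ => (h a b).mul_const (v b)
    simpa [hp] using h1
  have hz0 : Tendsto (fun k : ℕ => z ^ k) atTop (𝓝 0) := by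
    have := hta.mul_const (v a)⁻¹
    simpa [mul_assoc, mul_inv_cancel₀ ha] using this
  have := tendsto_pow_atTop_nhds_zero_iff_norm_lt_one.1 hz0
  exact_mod_cast this

/-- The powers of `T` tend to zero pointwise. -/
def PowersVanish {E : Type*} [AddCommGroup E] [Module ℝ E] [TopologicalSpace E]
    (T : E →ₗ[ℝ] E) : Prop :=
  ∀ V, Tendsto (fun k : ℕ => (T ^ k) V) atTop (𝓝 0)

/-- On a finite-dimensional space the spectral radius is below one if and only if the powers
tend to zero. -/
lemma spectralRad_lt_one_iff {E : Type*} [AddCommGroup E] [Module ℝ E] [TopologicalSpace E]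
    [IsTopologicalAddGroup E] [ContinuousSMul ℝ E] [T2Space E] [FiniteDimensional ℝ E]
    (T : E →ₗ[ℝ] E) : spectralRad T < 1 ↔ PowersVanish T := by
  let b := Module.finBasis ℝ E
  let M := LinearMap.toMatrix b b T
  have hM : spectralRad T = spectralRadius ℂ (M.map (algebraMap ℝ ℂ)) := by
    rw [spectralRad, spectralRadius, spectralRadius, ← LinearMap.toMatrix_baseChange,
      LinearMap.spectrum_toMatrix]
  have hMk (k : ℕ) : (M.map (algebraMap ℝ ℂ)) ^ k
      = (LinearMap.toMatrix b b (T ^ k)).map (algebraMap ℝ ℂ) := by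
    rw [← LinearMap.toMatrix_pow]
    exact (map_pow (algebraMap ℝ ℂ).mapMatrix M k).symm
  rw [hM]
  constructor
  · intro h V
    have ht := tendsto_pow_of_spectralRadius_lt_one h
    have hent : Tendsto (fun k => LinearMap.toMatrix b b (T ^ k)) atTop (𝓝 0) := by
      refine tendsto_pi_nhds.2 fun i => tendsto_pi_nhds.2 fun j => ?_
      have h1 := ht i j
      simp only [hMk] at h1
      have h2 := (Complex.continuous_re.tendsto _).comp h1
      simpa [Function.comp_def] using h2
    have hc : Continuous fun N : Matrix _ _ ℝ => b.equivFun.symm (N *ᵥ b.equivFun V) := by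
      have : Continuous b.equivFun.symm :=
        LinearMap.continuous_of_finiteDimensional b.equivFun.symm.toLinearMap
      fun_prop
    have := (hc.tendsto 0).comp hent
    simp only [Matrix.zero_mulVec, map_zero] at this
    refine this.congr fun k => ?_
    simp only [Function.comp]
    rw [LinearEquiv.symm_apply_eq]
    exact LinearMap.toMatrix_mulVec_repr b b (T ^ k) V
  · intro h
    refine spectralRadius_lt_one_of_tendsto_pow fun i j => ?_
    simp only [hMk]
    have hc : Continuous b.equivFun :=
      LinearMap.continuous_of_finiteDimensional b.equivFun.toLinearMap
    have h1 := (hc.tendsto 0).comp (h (b j))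
    simp only [map_zero] at h1
    have h2 := (Complex.continuous_ofReal.tendsto _).comp (tendsto_pi_nhds.1 h1 i)
    simpa [Function.comp_def, LinearMap.toMatrix_apply] using h2

/-! ### Real positive semidefinite matrices and traces. -/

section RealMatrix

variable {κ ν : Type*} [Fintype κ] [Fintype ν]

lemma posSemidef_mul_mul_transpose {X : Matrix κ κ ℝ} (hX : X.PosSemidef) (B : Matrix ν κ ℝ) :
    (B * X * Bᵀ).PosSemidef := by
  simpa using hX.mul_mul_conjTranspose_same B

lemma posSemidef_transpose_mul_mul {X : Matrix κ κ ℝ} (hX : X.PosSemidef) (B : Matrix κ ν ℝ) :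
    (Bᵀ * X * B).PosSemidef := by
  simpa using hX.conjTranspose_mul_mul_same B

lemma posSemidef_real_iff {X : Matrix κ κ ℝ} :
    X.PosSemidef ↔ Xᵀ = X ∧ ∀ x, 0 ≤ x ⬝ᵥ X *ᵥ x := by
  simp [Matrix.posSemidef_iff_dotProduct_mulVec, Matrix.IsHermitian]

lemma isClosed_setOf_posSemidef : IsClosed {X : Matrix κ κ ℝ | X.PosSemidef} := by
  simp only [posSemidef_real_iff, Set.ofPred_and, Set.ofPred_forall]
  refine (isClosed_eq (by fun_prop) continuous_id).inter
    (isClosed_iInter fun x => isClosed_le continuous_const ?_)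
  fun_prop

lemma exists_eq_transpose_mul_self {X : Matrix κ κ ℝ} (hX : X.PosSemidef) :
    ∃ B : Matrix κ κ ℝ, X = Bᵀ * B := by
  classical
  open scoped MatrixOrder in
  obtain ⟨B, hB⟩ := CStarAlgebra.nonneg_iff_eq_star_mul_self.1
    (Matrix.nonneg_iff_posSemidef.2 hX)
  exact ⟨B, by simpa [Matrix.star_eq_conjTranspose] using hB⟩

lemma trace_mul_nonneg {U V : Matrix κ κ ℝ} (hU : U.PosSemidef) (hV : V.PosSemidef) :
    0 ≤ (U * V).trace := by
  obtain ⟨B, rfl⟩ := exists_eq_transpose_mul_self hU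
  rw [mul_assoc, Matrix.trace_mul_comm]
  exact (posSemidef_mul_mul_transpose hV B).trace_nonneg

/-- A positive semidefinite matrix that is trace orthogonal to `K M Kᵀ`, `M` positive definite,
annihilates `K`. -/
lemma mul_eq_zero_of_trace_mul_posDef {U : Matrix κ κ ℝ} {M : Matrix ν ν ℝ} {K : Matrix κ ν ℝ}
    (hU : U.PosSemidef) (hM : M.PosDef) (h : (U * (K * M * Kᵀ)).trace = 0) : U * K = 0 := by
  obtain ⟨B, rfl⟩ := exists_eq_transpose_mul_self hU
  -- By cyclicity the trace is that of a positive semidefinite matrix, which therefore vanishes;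
  -- definiteness of `M` then kills `(B * K)ᵀ` on each basis vector.
  have h1 : ((B * K) * M * (B * K)ᵀ).trace = 0 := by
    rw [← h, mul_assoc Bᵀ, Matrix.trace_mul_comm Bᵀ]
    simp [Matrix.mul_assoc]
  have h2 := ((posSemidef_mul_mul_transpose hM.posSemidef (B * K)).trace_eq_zero_iff).1 h1
  classical
  have h3 : (B * K)ᵀ = 0 := by
    refine Matrix.ext_of_mulVec_single fun a => ?_
    by_contra hne
    have h4 := hM.dotProduct_mulVec_pos (x := (B * K)ᵀ *ᵥ Pi.single a 1) (by rwa [Matrix.zero_mulVec] at hne)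
    have h5 : Pi.single a 1 ⬝ᵥ ((B * K) * M * (B * K)ᵀ) *ᵥ Pi.single a 1 = 0 := by
      rw [h2, Matrix.zero_mulVec, dotProduct_zero]
    rw [← Matrix.mulVec_mulVec, ← Matrix.mulVec_mulVec, Matrix.dotProduct_mulVec,
      ← Matrix.mulVec_transpose] at h5
    simp only [star_trivial] at h4
    exact h4.ne' h5
  rw [Matrix.transpose_eq_zero] at h3
  rw [Matrix.mul_assoc, h3, Matrix.mul_zero]

lemma mul_eq_zero_of_trace_mul {U V : Matrix κ κ ℝ}
    (hU : U.PosSemidef) (hV : V.PosSemidef) (h : (U * V).trace = 0) : U * V = 0 := by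
  classical
  obtain ⟨B, rfl⟩ := exists_eq_transpose_mul_self hV
  have := mul_eq_zero_of_trace_mul_posDef (K := Bᵀ) hU Matrix.PosDef.one (by simpa using h)
  rw [← mul_assoc, this, zero_mul]

/-- Testing on e_a ± e_b gives 2|X_ab| ≤ X_aa + X_bb, and each diagonal entry is at most the trace.
-/
lemma abs_apply_le_trace {X : Matrix κ κ ℝ} (hX : X.PosSemidef) (a b : κ) :
    |X a b| ≤ X.trace := by
  classical
  have hd (c : κ) : X c c ≤ X.trace :=
    Finset.single_le_sum (f := fun c => X c c) (fun c _ => hX.diag_nonneg) (Finset.mem_univ c)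
  have hs : X b a = X a b := by
    have := congrFun (congrFun (posSemidef_real_iff.1 hX).1 a) b
    simpa using this
  have h1 := (posSemidef_real_iff.1 hX).2 (Pi.single a 1 + Pi.single b 1)
  have h2 := (posSemidef_real_iff.1 hX).2 (Pi.single a 1 - Pi.single b 1)
  simp [Matrix.mulVec_add, Matrix.mulVec_sub, hs] at h1 h2
  rw [abs_le]
  constructor <;> linarith [hd a, hd b]

end RealMatrix

/-! ### Tuples of matrices, the trace pairing and Lyapunov equations. -/

section Tuple

variable {ι : Type*} {n : ℕ}

/-- All entries of a tuple of matrices are positive semidefinite. -/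
def AllPosSemidef (V : ι → Matrix (Fin n) (Fin n) ℝ) : Prop := ∀ i, (V i).PosSemidef

lemma allPosSemidef_one : AllPosSemidef (1 : ι → Matrix (Fin n) (Fin n) ℝ) :=
  fun _ => Matrix.PosSemidef.one

lemma AllPosSemidef.add {V W : ι → Matrix (Fin n) (Fin n) ℝ} (hV : AllPosSemidef V)
    (hW : AllPosSemidef W) : AllPosSemidef (V + W) := fun i => (hV i).add (hW i)

lemma AllPosSemidef.smul {V : ι → Matrix (Fin n) (Fin n) ℝ} (hV : AllPosSemidef V)
    {c : ℝ} (hc : 0 ≤ c) : AllPosSemidef (c • V) := fun i => (hV i).smul hc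

lemma allPosSemidef_of_tendsto {V : ℕ → ι → Matrix (Fin n) (Fin n) ℝ}
    {W : ι → Matrix (Fin n) (Fin n) ℝ} (hV : ∀ k, AllPosSemidef (V k))
    (h : Tendsto V atTop (𝓝 W)) : AllPosSemidef W := fun i =>
  isClosed_setOf_posSemidef.mem_of_tendsto (tendsto_pi_nhds.1 h i)
    (Eventually.of_forall fun k => hV k i)

variable [Fintype ι]

/-- The trace pairing of two tuples of matrices. -/
def tracePairing (U V : ι → Matrix (Fin n) (Fin n) ℝ) : ℝ := ∑ i, (U i * V i).trace

/-- The adjoint `U ↦ (∑ j, P i j • (F i)ᵀ * U j * F i)_i` of the jump operator for the trace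
pairing. -/
def jumpAdjoint (P : Matrix ι ι ℝ) (F : ι → Matrix (Fin n) (Fin n) ℝ) :
    (ι → Matrix (Fin n) (Fin n) ℝ) →ₗ[ℝ] (ι → Matrix (Fin n) (Fin n) ℝ) where
  toFun U i := ∑ j, P i j • ((F i)ᵀ * U j * F i)
  map_add' V W := by
    funext j
    simp [mul_add, add_mul, Finset.sum_add_distrib]
  map_smul' c V := by
    funext j
    simp [Finset.smul_sum, smul_comm c]

lemma jumpOperator_apply (P : Matrix ι ι ℝ) (F : ι → Matrix (Fin n) (Fin n) ℝ)
    (V : ι → Matrix (Fin n) (Fin n) ℝ) (j : ι) :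
    jumpOperator P F V j = ∑ i, P i j • (F i * V i * (F i)ᵀ) := rfl

lemma jumpAdjoint_apply (P : Matrix ι ι ℝ) (F : ι → Matrix (Fin n) (Fin n) ℝ)
    (U : ι → Matrix (Fin n) (Fin n) ℝ) (i : ι) :
    jumpAdjoint P F U i = ∑ j, P i j • ((F i)ᵀ * U j * F i) := rfl

lemma tracePairing_add_right (U V W : ι → Matrix (Fin n) (Fin n) ℝ) :
    tracePairing U (V + W) = tracePairing U V + tracePairing U W := by
  simp [tracePairing, mul_add, Finset.sum_add_distrib]

lemma tracePairing_sub_right (U V W : ι → Matrix (Fin n) (Fin n) ℝ) :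
    tracePairing U (V - W) = tracePairing U V - tracePairing U W := by
  simp [tracePairing, mul_sub, Finset.sum_sub_distrib]

lemma tracePairing_sub_left (U V W : ι → Matrix (Fin n) (Fin n) ℝ) :
    tracePairing (U - V) W = tracePairing U W - tracePairing V W := by
  simp [tracePairing, sub_mul, Finset.sum_sub_distrib]

lemma tracePairing_smul_left (c : ℝ) (U V : ι → Matrix (Fin n) (Fin n) ℝ) :
    tracePairing (c • U) V = c * tracePairing U V := by
  simp [tracePairing, Finset.mul_sum]

lemma tracePairing_nonneg {U V : ι → Matrix (Fin n) (Fin n) ℝ} (hU : AllPosSemidef U)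
    (hV : AllPosSemidef V) : 0 ≤ tracePairing U V :=
  Finset.sum_nonneg fun i _ => trace_mul_nonneg (hU i) (hV i)

lemma tracePairing_jumpOperator (P : Matrix ι ι ℝ) (F : ι → Matrix (Fin n) (Fin n) ℝ)
    (U V : ι → Matrix (Fin n) (Fin n) ℝ) :
    tracePairing U (jumpOperator P F V) = tracePairing (jumpAdjoint P F U) V := by
  simp only [tracePairing, jumpOperator_apply, jumpAdjoint_apply, Finset.mul_sum, Finset.sum_mul,
    Matrix.trace_sum, mul_smul_comm, smul_mul_assoc, Matrix.trace_smul]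
  rw [Finset.sum_comm]
  refine Finset.sum_congr rfl fun i _ => Finset.sum_congr rfl fun j _ => ?_
  congr 1
  rw [← mul_assoc, Matrix.trace_mul_comm]
  simp [mul_assoc]

lemma tracePairing_jumpOperator_pow (P : Matrix ι ι ℝ) (F : ι → Matrix (Fin n) (Fin n) ℝ) (k : ℕ)
    (U V : ι → Matrix (Fin n) (Fin n) ℝ) :
    tracePairing U ((jumpOperator P F ^ k) V) = tracePairing ((jumpAdjoint P F ^ k) U) V := by
  induction k generalizing U with
  | zero => simp
  | succ k ih =>
    rw [pow_succ', pow_succ, Module.End.mul_apply, Module.End.mul_apply,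
      tracePairing_jumpOperator, ih]

lemma continuous_tracePairing_right (U : ι → Matrix (Fin n) (Fin n) ℝ) :
    Continuous fun V => tracePairing U V := by
  unfold tracePairing
  fun_prop

lemma allPosSemidef_jumpOperator {P : Matrix ι ι ℝ} (hP : ∀ i j, 0 ≤ P i j)
    (F : ι → Matrix (Fin n) (Fin n) ℝ) {V : ι → Matrix (Fin n) (Fin n) ℝ} (hV : AllPosSemidef V) :
    AllPosSemidef (jumpOperator P F V) := fun j =>
  Matrix.posSemidef_sum _ fun i _ => (posSemidef_mul_mul_transpose (hV i) _).smul (hP i j)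

lemma allPosSemidef_jumpAdjoint {P : Matrix ι ι ℝ} (hP : ∀ i j, 0 ≤ P i j)
    (F : ι → Matrix (Fin n) (Fin n) ℝ) {V : ι → Matrix (Fin n) (Fin n) ℝ} (hV : AllPosSemidef V) :
    AllPosSemidef (jumpAdjoint P F V) := fun i =>
  Matrix.posSemidef_sum _ fun j _ => (posSemidef_transpose_mul_mul (hV j) _).smul (hP i j)

omit [Fintype ι] in
/-- Solutions of the Lyapunov equation of a positive operator whose powers vanish are positive
semidefinite. -/
lemma allPosSemidef_of_eq_add
    {T : (ι → Matrix (Fin n) (Fin n) ℝ) →ₗ[ℝ] (ι → Matrix (Fin n) (Fin n) ℝ)}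
    (hT : PowersVanish T) (hpos : ∀ V, AllPosSemidef V → AllPosSemidef (T V))
    {Y G : ι → Matrix (Fin n) (Fin n) ℝ} (hG : AllPosSemidef G) (hY : Y = T Y + G) :
    AllPosSemidef Y := by
  -- The difference is the partial sum ∑_{r<k} T^r G of positive tuples.
  have hD (k : ℕ) : AllPosSemidef (Y - (T ^ k) Y) := by
    induction k with
    | zero =>
      intro i
      simpa using Matrix.PosSemidef.zero
    | succ k ih =>
      have : Y - (T ^ (k + 1)) Y = G + T (Y - (T ^ k) Y) := by
        rw [pow_succ', Module.End.mul_apply, map_sub]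
        nth_rw 1 [hY]
        abel
      rw [this]
      exact hG.add (hpos _ ih)
  refine allPosSemidef_of_tendsto hD ?_
  simpa using tendsto_const_nhds.sub (hT Y)

/-- The Lyapunov equation of an operator whose powers vanish is solvable. -/
lemma exists_eq_add {T : (ι → Matrix (Fin n) (Fin n) ℝ) →ₗ[ℝ] (ι → Matrix (Fin n) (Fin n) ℝ)}
    (hT : PowersVanish T) (G : ι → Matrix (Fin n) (Fin n) ℝ) : ∃ Y, Y = T Y + G := by
  -- A fixed point of `T` equals all its iterates, hence their limit 0; in finite dimension
  -- injectivity of id - T gives surjectivity.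
  have hinj : Function.Injective
      (LinearMap.id (R := ℝ) (M := ι → Matrix (Fin n) (Fin n) ℝ) - T) := by
    rw [← LinearMap.ker_eq_bot, LinearMap.ker_eq_bot']
    intro V hV
    have hV1 : T V = V := (sub_eq_zero.1 hV).symm
    have hk (k : ℕ) : (T ^ k) V = V := by
      induction k with
      | zero => simp
      | succ k ih => rw [pow_succ, Module.End.mul_apply, hV1, ih]
    exact tendsto_nhds_unique tendsto_const_nhds ((hT V).congr hk)
  obtain ⟨Y, hY⟩ := LinearMap.injective_iff_surjective.1 hinj G
  exact ⟨Y, by simp [← hY]⟩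

end Tuple

/-! ### Lyapunov criteria and limits of stable jump operators. -/

section Stability

variable {ι : Type*} [Fintype ι] {n : ℕ}

lemma allPosSemidef_jumpOperator_pow {P : Matrix ι ι ℝ} (hP : ∀ i j, 0 ≤ P i j)
    (F : ι → Matrix (Fin n) (Fin n) ℝ) {V : ι → Matrix (Fin n) (Fin n) ℝ} (hV : AllPosSemidef V)
    (k : ℕ) : AllPosSemidef ((jumpOperator P F ^ k) V) := by
  induction k with
  | zero => simpa using hV
  | succ k ih =>
    rw [pow_succ', Module.End.mul_apply]
    exact allPosSemidef_jumpOperator hP F ih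

/-- The bilinear forms of `V` are dominated by the quadratic forms of `W`. -/
def IsDominated (V W : ι → Matrix (Fin n) (Fin n) ℝ) : Prop :=
  ∀ i x y, |x ⬝ᵥ V i *ᵥ y| ≤ x ⬝ᵥ W i *ᵥ x + y ⬝ᵥ W i *ᵥ y

lemma dotProduct_jumpOperator_mulVec (P : Matrix ι ι ℝ) (F : ι → Matrix (Fin n) (Fin n) ℝ)
    (V : ι → Matrix (Fin n) (Fin n) ℝ) (j : ι) (x y : Fin n → ℝ) :
    x ⬝ᵥ jumpOperator P F V j *ᵥ y =
      ∑ i, P i j * (((F i)ᵀ *ᵥ x) ⬝ᵥ V i *ᵥ ((F i)ᵀ *ᵥ y)) := by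
  rw [jumpOperator_apply, Matrix.sum_mulVec, dotProduct_sum]
  refine Finset.sum_congr rfl fun i _ => ?_
  rw [Matrix.smul_mulVec, dotProduct_smul, smul_eq_mul, ← Matrix.mulVec_mulVec,
    ← Matrix.mulVec_mulVec, Matrix.dotProduct_mulVec, ← Matrix.mulVec_transpose]

/-- The new forms are nonnegative combinations of the old ones at transformed vectors. Domination
lets the iterates of the identity tuple control those of an arbitrary tuple, symmetric or not. -/
lemma IsDominated.jumpOperator {P : Matrix ι ι ℝ} (hP : ∀ i j, 0 ≤ P i j)
    (F : ι → Matrix (Fin n) (Fin n) ℝ) {V W : ι → Matrix (Fin n) (Fin n) ℝ}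
    (h : IsDominated V W) :
    IsDominated (jumpOperator P F V) (jumpOperator P F W) := by
  intro j x y
  simp only [dotProduct_jumpOperator_mulVec, ← Finset.sum_add_distrib, ← mul_add]
  refine (Finset.abs_sum_le_sum_abs _ _).trans (Finset.sum_le_sum fun i _ => ?_)
  rw [abs_mul, abs_of_nonneg (hP i j)]
  exact mul_le_mul_of_nonneg_left (h i _ _) (hP i j)

lemma IsDominated.jumpOperator_pow {P : Matrix ι ι ℝ} (hP : ∀ i j, 0 ≤ P i j)
    (F : ι → Matrix (Fin n) (Fin n) ℝ) {V W : ι → Matrix (Fin n) (Fin n) ℝ}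
    (h : IsDominated V W) (k : ℕ) :
    IsDominated ((JumpFilter.jumpOperator P F ^ k) V) ((JumpFilter.jumpOperator P F ^ k) W) := by
  induction k with
  | zero => simpa using h
  | succ k ih =>
    rw [pow_succ', Module.End.mul_apply, Module.End.mul_apply]
    exact ih.jumpOperator hP F

lemma exists_isDominated_smul_one (V : ι → Matrix (Fin n) (Fin n) ℝ) :
    ∃ c : ℝ, IsDominated V (c • 1) := by
  refine ⟨∑ i, ∑ a, ∑ b, |V i a b|, fun i x y => ?_⟩
  have hx (x : Fin n → ℝ) (a : Fin n) : x a ^ 2 ≤ x ⬝ᵥ x := by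
    rw [sq]
    exact Finset.single_le_sum (f := fun a => x a * x a) (fun a _ => mul_self_nonneg _)
      (Finset.mem_univ a)
  have hxy (a b : Fin n) : |x a| * |y b| ≤ x ⬝ᵥ x + y ⬝ᵥ y := by
    have h1 := hx x a
    have h2 := hx y b
    rw [← sq_abs] at h1 h2
    nlinarith [sq_nonneg (|x a| - |y b|), sq_nonneg (|x a|), sq_nonneg (|y b|)]
  have hnn : 0 ≤ x ⬝ᵥ x + y ⬝ᵥ y :=
    add_nonneg (Finset.sum_nonneg fun a _ => mul_self_nonneg _)
      (Finset.sum_nonneg fun a _ => mul_self_nonneg _)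
  calc |x ⬝ᵥ V i *ᵥ y| ≤ ∑ a, ∑ b, |V i a b| * (|x a| * |y b|) := by
        simp only [dotProduct, Matrix.mulVec, Finset.mul_sum]
        refine (Finset.abs_sum_le_sum_abs _ _).trans (Finset.sum_le_sum fun a _ => ?_)
        refine (Finset.abs_sum_le_sum_abs _ _).trans (Finset.sum_le_sum fun b _ => ?_)
        rw [abs_mul, abs_mul]
        exact le_of_eq (by ring)
    _ ≤ (∑ a, ∑ b, |V i a b|) * (x ⬝ᵥ x + y ⬝ᵥ y) := by
        simp only [Finset.sum_mul]
        exact Finset.sum_le_sum fun a _ => Finset.sum_le_sum fun b _ =>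
          mul_le_mul_of_nonneg_left (hxy a b) (abs_nonneg _)
    _ ≤ (∑ i, ∑ a, ∑ b, |V i a b|) * (x ⬝ᵥ x + y ⬝ᵥ y) := by
        refine mul_le_mul_of_nonneg_right ?_ hnn
        exact Finset.single_le_sum (f := fun i => ∑ a, ∑ b, |V i a b|)
          (fun i _ => Finset.sum_nonneg fun a _ => Finset.sum_nonneg fun b _ => abs_nonneg _)
          (Finset.mem_univ i)
    _ = _ := by
        simp [Matrix.smul_mulVec, mul_add]

lemma abs_apply_le_tracePairing_one {X : ι → Matrix (Fin n) (Fin n) ℝ} (hX : AllPosSemidef X)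
    (i : ι) (a b : Fin n) : |X i a b| ≤ tracePairing 1 X := by
  refine (abs_apply_le_trace (hX i) a b).trans ?_
  simp only [tracePairing, Pi.one_apply, one_mul]
  exact Finset.single_le_sum (f := fun i => (X i).trace) (fun i _ => (hX i).trace_nonneg)
    (Finset.mem_univ i)

/-- If the iterates of the tuple of identity matrices have bounded total trace, then the powers of
the jump operator vanish. -/
lemma powersVanish_of_sum_le {P : Matrix ι ι ℝ} (hP : ∀ i j, 0 ≤ P i j)
    {F : ι → Matrix (Fin n) (Fin n) ℝ} {B : ℝ}
    (hB : ∀ k : ℕ, ∑ r ∈ Finset.range k, tracePairing 1 ((jumpOperator P F ^ r) 1) ≤ B) :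
    PowersVanish (jumpOperator P F) := by
  have hpsd (k : ℕ) := allPosSemidef_jumpOperator_pow hP F (allPosSemidef_one (ι := ι) (n := n)) k
  have htr : Tendsto (fun k : ℕ => tracePairing 1 ((jumpOperator P F ^ k) 1)) atTop (𝓝 0) :=
    (summable_of_sum_range_le (fun k => tracePairing_nonneg allPosSemidef_one (hpsd k))
      hB).tendsto_atTop_zero
  intro V
  obtain ⟨c, hc⟩ := exists_isDominated_smul_one V
  refine tendsto_pi_nhds.2 fun i => tendsto_pi_nhds.2 fun a => tendsto_pi_nhds.2 fun b => ?_
  refine squeeze_zero_norm (a := fun k => |c| * (tracePairing 1 ((jumpOperator P F ^ k) 1)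
    + tracePairing 1 ((jumpOperator P F ^ k) 1))) (fun k => ?_)
    (by simpa using (htr.add htr).const_mul |c|)
  have h1 := hc.jumpOperator_pow hP F k i (Pi.single a 1) (Pi.single b 1)
  have h2 (a : Fin n) : c * ((jumpOperator P F ^ k) 1) i a a
      ≤ |c| * tracePairing 1 ((jumpOperator P F ^ k) 1) :=
    (le_abs_self _).trans (by
      rw [abs_mul]
      exact mul_le_mul_of_nonneg_left (abs_apply_le_tracePairing_one (hpsd k) i a a) (abs_nonneg c))
  have h3 : |((jumpOperator P F ^ k) V) i a b|
      ≤ c * ((jumpOperator P F ^ k) 1) i a a + c * ((jumpOperator P F ^ k) 1) i b b := by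
    simpa using h1
  rw [Real.norm_eq_abs, mul_add]
  exact h3.trans (add_le_add (h2 a) (h2 b))

/-- Lyapunov criterion for the jump operator. -/
lemma powersVanish_of_sub_jumpOperator {P : Matrix ι ι ℝ} (hP : ∀ i j, 0 ≤ P i j)
    {F W : ι → Matrix (Fin n) (Fin n) ℝ} {c : ℝ} (hc : 0 < c) (hW : AllPosSemidef W)
    (h : AllPosSemidef (W - jumpOperator P F W - c • 1)) : PowersVanish (jumpOperator P F) := by
  -- Iterating W ≥ TW + c·1 bounds c ∑_{r<k} T^r 1 by W - T^k W, hence by W.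
  have hD (k : ℕ) : AllPosSemidef
      (W - (jumpOperator P F ^ k) W - c • ∑ r ∈ Finset.range k, (jumpOperator P F ^ r) 1) := by
    induction k with
    | zero =>
      intro i
      simpa using Matrix.PosSemidef.zero
    | succ k ih =>
      have : W - (jumpOperator P F ^ (k + 1)) W
          - c • ∑ r ∈ Finset.range (k + 1), (jumpOperator P F ^ r) 1
          = jumpOperator P F (W - (jumpOperator P F ^ k) W
            - c • ∑ r ∈ Finset.range k, (jumpOperator P F ^ r) 1)
            + (W - jumpOperator P F W - c • 1) := by
        rw [Finset.sum_range_succ']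
        simp only [map_sub, map_smul, map_sum, pow_succ', Module.End.mul_apply, pow_zero,
          Module.End.one_apply, smul_add]
        abel
      rw [this]
      exact (allPosSemidef_jumpOperator hP F ih).add h
  refine powersVanish_of_sum_le hP (B := c⁻¹ * tracePairing 1 W) fun k => ?_
  have hWk := tracePairing_nonneg allPosSemidef_one (allPosSemidef_jumpOperator_pow hP F hW k)
  have hk := tracePairing_nonneg allPosSemidef_one (hD k)
  have hs : tracePairing 1 (c • ∑ r ∈ Finset.range k, (jumpOperator P F ^ r) 1)
      = c * ∑ r ∈ Finset.range k, tracePairing 1 ((jumpOperator P F ^ r) 1) := by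
    simp only [tracePairing, Pi.one_apply, one_mul, Pi.smul_apply, Matrix.trace_smul,
      Finset.sum_apply, Matrix.trace_sum, smul_eq_mul, Finset.mul_sum]
    rw [Finset.sum_comm]
  rw [tracePairing_sub_right, tracePairing_sub_right, hs] at hk
  rw [← div_eq_inv_mul, le_div_iff₀ hc]
  linarith

/-- Lyapunov criterion for the adjoint of the jump operator. -/
lemma powersVanish_of_sub_jumpAdjoint {P : Matrix ι ι ℝ} (hP : ∀ i j, 0 ≤ P i j)
    {F U : ι → Matrix (Fin n) (Fin n) ℝ} {c : ℝ} (hc : 0 < c) (hU : AllPosSemidef U)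
    (h : U - jumpAdjoint P F U = c • 1) : PowersVanish (jumpOperator P F) := by
  have hpsd (k : ℕ) := allPosSemidef_jumpOperator_pow hP F (allPosSemidef_one (ι := ι) (n := n)) k
  -- Moving one factor to the adjoint makes the sum of traces telescope.
  have hstep (k : ℕ) : c * tracePairing 1 ((jumpOperator P F ^ k) 1)
      = tracePairing U ((jumpOperator P F ^ k) 1)
        - tracePairing U ((jumpOperator P F ^ (k + 1)) 1) := by
    rw [pow_succ', Module.End.mul_apply, tracePairing_jumpOperator, ← tracePairing_sub_left, h,
      tracePairing_smul_left]
  refine powersVanish_of_sum_le hP (B := c⁻¹ * tracePairing U 1) fun k => ?_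
  have hs : c * ∑ r ∈ Finset.range k, tracePairing 1 ((jumpOperator P F ^ r) 1)
      = tracePairing U 1 - tracePairing U ((jumpOperator P F ^ k) 1) := by
    rw [Finset.mul_sum, Finset.sum_congr rfl fun r _ => hstep r, Finset.sum_range_sub']
    simp
  have := tracePairing_nonneg hU (hpsd k)
  rw [← div_eq_inv_mul, le_div_iff₀ hc]
  linarith

/-- Each entry is a trace pairing with a matrix unit, so the powers can be moved from the adjoint to
the operator. -/
lemma powersVanish_jumpAdjoint {P : Matrix ι ι ℝ} {F : ι → Matrix (Fin n) (Fin n) ℝ}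
    (h : PowersVanish (jumpOperator P F)) : PowersVanish (jumpAdjoint P F) := by
  classical
  intro U
  refine tendsto_pi_nhds.2 fun i => tendsto_pi_nhds.2 fun a => tendsto_pi_nhds.2 fun b => ?_
  have hent (X : ι → Matrix (Fin n) (Fin n) ℝ) :
      X i a b = tracePairing X (Pi.single i (Matrix.single b a 1)) := by
    rw [tracePairing, Finset.sum_eq_single i]
    · simp [Matrix.trace_mul_single]
    · intro j _ hj
      simp [hj]
    · simp
  simp only [hent _, ← tracePairing_jumpOperator_pow]
  have := ((continuous_tracePairing_right U).tendsto 0).comp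
    (h (Pi.single i (Matrix.single b a 1)))
  simpa [tracePairing, Function.comp_def] using this

/-- The adjoint of a jump operator whose powers vanish has no nonzero fixed point. -/
lemma eq_zero_of_jumpAdjoint_eq {P : Matrix ι ι ℝ} {F : ι → Matrix (Fin n) (Fin n) ℝ}
    (h : PowersVanish (jumpOperator P F)) {U : ι → Matrix (Fin n) (Fin n) ℝ}
    (hU : jumpAdjoint P F U = U) : U = 0 := by
  have hk (k : ℕ) : (jumpAdjoint P F ^ k) U = U := by
    induction k with
    | zero => simp
    | succ k ih => rw [pow_succ, Module.End.mul_apply, hU, ih]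
  exact tendsto_nhds_unique tendsto_const_nhds ((powersVanish_jumpAdjoint h U).congr hk)

/-- A limit of jump operators with vanishing powers either has vanishing powers, or its adjoint
has a positive semidefinite fixed point. -/
lemma powersVanish_or_exists_jumpAdjoint_eq {P : Matrix ι ι ℝ} (hP : ∀ i j, 0 ≤ P i j)
    {F : ℕ → ι → Matrix (Fin n) (Fin n) ℝ} {G : ι → Matrix (Fin n) (Fin n) ℝ}
    (hF : ∀ k, PowersVanish (jumpOperator P (F k))) (hFG : Tendsto F atTop (𝓝 G)) :
    PowersVanish (jumpOperator P G) ∨ ∃ U, AllPosSemidef U ∧ U ≠ 0 ∧ jumpAdjoint P G U = U := by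
  have hex (k : ℕ) := exists_eq_add (powersVanish_jumpAdjoint (hF k)) 1
  choose U hUeq using hex
  have hU (k : ℕ) : AllPosSemidef (U k) :=
    allPosSemidef_of_eq_add (powersVanish_jumpAdjoint (hF k))
      (fun V hV => allPosSemidef_jumpAdjoint hP (F k) hV) allPosSemidef_one (hUeq k)
  have ht (k : ℕ) : 0 ≤ tracePairing 1 (U k) := tracePairing_nonneg allPosSemidef_one (hU k)
  -- With this scaling the trace of `X k` and `s k` add up to 1, so the pairs stay in a compact set
  -- even if the `U k` are unbounded.
  let s : ℕ → ℝ := fun k => (1 + tracePairing 1 (U k))⁻¹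
  have hs0 (k : ℕ) : 0 < s k := inv_pos.2 (by linarith [ht k])
  let X : ℕ → ι → Matrix (Fin n) (Fin n) ℝ := fun k => s k • U k
  have hXpsd (k : ℕ) : AllPosSemidef (X k) := (hU k).smul (hs0 k).le
  have hXtr (k : ℕ) : tracePairing 1 (X k) + s k = 1 := by
    have h1 : tracePairing 1 (X k) = s k * tracePairing 1 (U k) := by
      simp [X, tracePairing, Finset.mul_sum]
    have h2 : (1 + tracePairing 1 (U k)) ≠ 0 := by linarith [ht k]
    rw [h1]
    simp only [s]
    field_simp
    ring
  have hXeq (k : ℕ) : X k - jumpAdjoint P (F k) (X k) = s k • 1 := by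
    simp only [X, map_smul, ← smul_sub]
    congr 1
    nth_rw 1 [hUeq k]
    abel
  have hK : IsCompact ((Set.univ.pi fun _ => Set.univ.pi fun _ => Set.univ.pi fun _ =>
      Set.Icc (-1) 1 : Set (ι → Matrix (Fin n) (Fin n) ℝ)) ×ˢ Set.Icc (0 : ℝ) 1) :=
    IsCompact.prod (isCompact_univ_pi fun _ => isCompact_univ_pi fun _ => isCompact_univ_pi
      fun _ => isCompact_Icc) isCompact_Icc
  have hmem (k : ℕ) : (X k, s k) ∈ ((Set.univ.pi fun _ => Set.univ.pi fun _ => Set.univ.pi fun _ =>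
      Set.Icc (-1) 1 : Set (ι → Matrix (Fin n) (Fin n) ℝ)) ×ˢ Set.Icc (0 : ℝ) 1) := by
    have h0 := tracePairing_nonneg allPosSemidef_one (hXpsd k)
    refine ⟨fun i _ a _ b _ => abs_le.1 ((abs_apply_le_tracePairing_one (hXpsd k) i a b).trans ?_),
      (hs0 k).le, ?_⟩ <;> linarith [hXtr k, hs0 k]
  have : FirstCountableTopology (ι → Matrix (Fin n) (Fin n) ℝ) :=
    inferInstanceAs (FirstCountableTopology (ι → Fin n → Fin n → ℝ))
  obtain ⟨⟨X', s'⟩, -, φ, hφ, hlim⟩ := hK.tendsto_subseq hmem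
  have hX : Tendsto (fun k => X (φ k)) atTop (𝓝 X') := (continuous_fst.tendsto _).comp hlim
  have hs : Tendsto (fun k => s (φ k)) atTop (𝓝 s') := (continuous_snd.tendsto _).comp hlim
  have hFφ : Tendsto (fun k => F (φ k)) atTop (𝓝 G) := hFG.comp hφ.tendsto_atTop
  have hX'psd : AllPosSemidef X' := allPosSemidef_of_tendsto (fun k => hXpsd (φ k)) hX
  have hs'0 : 0 ≤ s' := ge_of_tendsto' hs fun k => (hs0 _).le
  have hX'tr : tracePairing 1 X' + s' = 1 :=
    tendsto_nhds_unique ((((continuous_tracePairing_right 1).tendsto _).comp hX).add hs)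
      (tendsto_const_nhds.congr fun k => (hXtr (φ k)).symm)
  have hcont : Continuous fun z : (ι → Matrix (Fin n) (Fin n) ℝ) × (ι → Matrix (Fin n) (Fin n) ℝ) =>
      z.2 - jumpAdjoint P z.1 z.2 := by
    refine continuous_pi fun i => ?_
    simp only [Pi.sub_apply, jumpAdjoint_apply]
    fun_prop
  have hX'eq : X' - jumpAdjoint P G X' = s' • 1 := by
    have h1 := (hcont.tendsto (G, X')).comp (hFφ.prodMk_nhds hX)
    refine tendsto_nhds_unique h1 ?_
    refine (hs.smul_const (1 : ι → Matrix (Fin n) (Fin n) ℝ)).congr fun k => ?_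
    exact (hXeq (φ k)).symm
  -- If s' = 0, the limit X' is a fixed point of trace 1; if s' > 0, it is a Lyapunov certificate of
  -- stability.
  rcases hs'0.eq_or_lt with h0 | hpos
  · right
    refine ⟨X', hX'psd, ?_, ?_⟩
    · rintro rfl
      rw [← h0] at hX'tr
      simp [tracePairing] at hX'tr
    · rw [← h0, zero_smul, sub_eq_zero] at hX'eq
      exact hX'eq.symm
  · exact Or.inl (powersVanish_of_sub_jumpAdjoint hP hpos hX'psd hX'eq)

end Stability

/-! ### Completion of squares and policy iteration for the CAREs. -/

section Riccati

/-- Completing the square in `L`: the left side is quadratic in `L` with leading coefficient `M`,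
and its minimizer is the negative Kalman gain. -/
lemma add_mul_mul_transpose_eq {κ ν : Type*} [Fintype κ] [Fintype ν] [DecidableEq ν]
    (A Y : Matrix κ κ ℝ) (H : Matrix ν κ ℝ) (S M : Matrix ν ν ℝ) (hY : Yᵀ = Y)
    (hM : M = H * Y * Hᵀ + S) (hMt : Mᵀ = M) (hdet : IsUnit M.det) (L : Matrix κ ν ℝ) :
    (A + L * H) * Y * (A + L * H)ᵀ + L * S * Lᵀ
      = A * Y * Aᵀ - A * Y * Hᵀ * M⁻¹ * (H * Y * Aᵀ)
        + (L + A * Y * Hᵀ * M⁻¹) * M * (L + A * Y * Hᵀ * M⁻¹)ᵀ := by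
  have hinv : (M⁻¹)ᵀ = M⁻¹ := by rw [Matrix.transpose_nonsing_inv, hMt]
  have h1 : A * Y * Hᵀ * M⁻¹ * M = A * Y * Hᵀ := Matrix.nonsing_inv_mul_cancel_right _ _ hdet
  have h2 : (A * Y * Hᵀ * M⁻¹)ᵀ = M⁻¹ * (H * Y * Aᵀ) := by
    simp only [Matrix.transpose_mul, hinv, hY, Matrix.transpose_transpose, Matrix.mul_assoc]
  have h3 : M * (M⁻¹ * (H * Y * Aᵀ)) = H * Y * Aᵀ := Matrix.mul_nonsing_inv_cancel_left _ _ hdet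
  have h4 : (L + A * Y * Hᵀ * M⁻¹) * M * (L + A * Y * Hᵀ * M⁻¹)ᵀ
      = L * M * Lᵀ + A * Y * Hᵀ * Lᵀ + L * (H * Y * Aᵀ) + A * Y * Hᵀ * M⁻¹ * (H * Y * Aᵀ) := by
    rw [Matrix.transpose_add L, h2, Matrix.add_mul, h1, Matrix.mul_add, Matrix.add_mul _ _ Lᵀ,
      Matrix.add_mul, Matrix.mul_assoc L M (M⁻¹ * _), h3, ← add_assoc, Matrix.mul_assoc _ M⁻¹]
  have h5 : L * M * Lᵀ = L * (H * Y * Hᵀ) * Lᵀ + L * S * Lᵀ := by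
    rw [hM, Matrix.mul_add, Matrix.add_mul]
  rw [h4, h5, Matrix.transpose_add, Matrix.transpose_mul]
  simp only [Matrix.mul_add, Matrix.add_mul, Matrix.mul_assoc]
  abel

variable {ι : Type*} [Fintype ι] {m n : ℕ}

/-- The driving term `∑ i, P i j • μ i • (L i * R * (L i)ᵀ + Q)` of the error covariance. -/
def noiseTerm (R : Matrix (Fin m) (Fin m) ℝ) (P : Matrix ι ι ℝ) (μ : ι → ℝ)
    (Q : Matrix (Fin n) (Fin n) ℝ) (L : ι → Matrix (Fin n) (Fin m) ℝ) (j : ι) :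
    Matrix (Fin n) (Fin n) ℝ :=
  ∑ i, P i j • μ i • (L i * R * (L i)ᵀ + Q)

omit [Fintype ι] in
lemma posDef_innovation {H : ι → Matrix (Fin m) (Fin n) ℝ} {R : Matrix (Fin m) (Fin m) ℝ}
    (hR : R.PosDef) {μ : ι → ℝ} (hμ : ∀ i, 0 < μ i) {Y : ι → Matrix (Fin n) (Fin n) ℝ}
    (hY : AllPosSemidef Y) (i : ι) : (H i * Y i * (H i)ᵀ + μ i • R).PosDef :=
  (hR.smul (hμ i)).posSemidef_add (posSemidef_mul_mul_transpose (hY i) (H i))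

/-- The excess of the error covariance under the gains `L` over the one under the Kalman gains. -/
def excess (A : Matrix (Fin n) (Fin n) ℝ) (H : ι → Matrix (Fin m) (Fin n) ℝ)
    (R : Matrix (Fin m) (Fin m) ℝ) (P : Matrix ι ι ℝ) (μ : ι → ℝ)
    (Y : ι → Matrix (Fin n) (Fin n) ℝ) (L : ι → Matrix (Fin n) (Fin m) ℝ) (j : ι) :
    Matrix (Fin n) (Fin n) ℝ :=
  ∑ i, P i j • ((L i + gain A H R μ Y i) * (H i * Y i * (H i)ᵀ + μ i • R)
    * (L i + gain A H R μ Y i)ᵀ)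

variable {A Q : Matrix (Fin n) (Fin n) ℝ} {H : ι → Matrix (Fin m) (Fin n) ℝ}
  {R : Matrix (Fin m) (Fin m) ℝ} {P : Matrix ι ι ℝ} {μ : ι → ℝ}

lemma allPosSemidef_excess (hR : R.PosDef) (hP : ∀ i j, 0 ≤ P i j) (hμ : ∀ i, 0 < μ i)
    {Y : ι → Matrix (Fin n) (Fin n) ℝ} (hY : AllPosSemidef Y)
    (L : ι → Matrix (Fin n) (Fin m) ℝ) : AllPosSemidef (excess A H R P μ Y L) := fun j =>
  Matrix.posSemidef_sum _ fun i _ => (posSemidef_mul_mul_transpose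
    (posDef_innovation hR hμ hY i).posSemidef _).smul (hP i j)

lemma allPosSemidef_noiseTerm (hQ : Q.PosSemidef) (hR : R.PosDef) (hP : ∀ i j, 0 ≤ P i j)
    (hμ : ∀ i, 0 < μ i) (L : ι → Matrix (Fin n) (Fin m) ℝ) :
    AllPosSemidef (noiseTerm R P μ Q L) := fun j =>
  Matrix.posSemidef_sum _ fun i _ =>
    (((posSemidef_mul_mul_transpose hR.posSemidef _).add hQ).smul (hμ i).le).smul (hP i j)

/-- Completion of squares for the error covariance. -/
lemma jumpOperator_add_noiseTerm (hR : R.PosDef) (hμ : ∀ i, 0 < μ i)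
    {Y : ι → Matrix (Fin n) (Fin n) ℝ} (hY : AllPosSemidef Y)
    (L : ι → Matrix (Fin n) (Fin m) ℝ) (j : ι) :
    jumpOperator P (fun i => A + L i * H i) Y j + noiseTerm R P μ Q L j
      = ∑ i, P i j • (A * Y i * Aᵀ
        - A * Y i * (H i)ᵀ * (H i * Y i * (H i)ᵀ + μ i • R)⁻¹ * (H i * Y i * Aᵀ) + μ i • Q)
        + excess A H R P μ Y L j := by
  rw [jumpOperator_apply, noiseTerm, excess, ← Finset.sum_add_distrib, ← Finset.sum_add_distrib]
  refine Finset.sum_congr rfl fun i _ => ?_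
  have hM := posDef_innovation (H := H) hR hμ hY i
  have h := add_mul_mul_transpose_eq A (Y i) (H i) (μ i • R) _ (posSemidef_real_iff.1 (hY i)).1 rfl
    (posSemidef_real_iff.1 hM.posSemidef).1 ((Matrix.isUnit_iff_isUnit_det _).1 hM.isUnit) (L i)
  simp only [Matrix.mul_smul, Matrix.smul_mul] at h
  rw [← smul_add, ← smul_add]
  congr 1
  rw [smul_add, ← add_assoc, h, gain, add_right_comm]

lemma excess_neg_gain (Y : ι → Matrix (Fin n) (Fin n) ℝ) :
    excess A H R P μ Y (fun i => -gain A H R μ Y i) = 0 := by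
  funext j
  simp [excess]

/-- The CAREs are the Lyapunov equation of the Kalman gains of `Y`, because the excess vanishes at
these gains. -/
lemma solvesCARE_iff (hR : R.PosDef) (hμ : ∀ i, 0 < μ i) {Y : ι → Matrix (Fin n) (Fin n) ℝ}
    (hY : AllPosSemidef Y) : SolvesCARE A H Q R P μ Y ↔
      Y = jumpOperator P (fun i => A + (-gain A H R μ Y i) * H i) Y
        + noiseTerm R P μ Q (fun i => -gain A H R μ Y i) := by
  rw [SolvesCARE, funext_iff]
  refine forall_congr' fun j => ?_
  rw [Pi.add_apply, jumpOperator_add_noiseTerm hR hμ hY, excess_neg_gain, Pi.zero_apply, add_zero]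

lemma jumpOperator_add_noiseTerm_eq (hR : R.PosDef) (hμ : ∀ i, 0 < μ i)
    {Y : ι → Matrix (Fin n) (Fin n) ℝ} (hY : AllPosSemidef Y)
    (L : ι → Matrix (Fin n) (Fin m) ℝ) :
    jumpOperator P (fun i => A + L i * H i) Y + noiseTerm R P μ Q L
      = jumpOperator P (fun i => A + (-gain A H R μ Y i) * H i) Y
        + noiseTerm R P μ Q (fun i => -gain A H R μ Y i) + excess A H R P μ Y L := by
  funext j
  simp only [Pi.add_apply]
  rw [jumpOperator_add_noiseTerm hR hμ hY, jumpOperator_add_noiseTerm hR hμ hY, excess_neg_gain,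
    Pi.zero_apply, add_zero]

/-- Stationarity of `μ` collapses the weights, so a change of process noise has an effect
independent of the gains. -/
lemma noiseTerm_sub (hst : ∀ j, ∑ i, μ i * P i j = μ j) (Q Q' : Matrix (Fin n) (Fin n) ℝ)
    (L : ι → Matrix (Fin n) (Fin m) ℝ) (j : ι) :
    noiseTerm R P μ Q L j - noiseTerm R P μ Q' L j = μ j • (Q - Q') := by
  rw [noiseTerm, noiseTerm, ← Finset.sum_sub_distrib, ← hst j, Finset.sum_smul]
  refine Finset.sum_congr rfl fun i _ => ?_
  rw [← smul_sub, ← smul_sub, add_sub_add_left_eq_sub, smul_smul, mul_comm]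

omit [Fintype ι] in
lemma exists_pos_forall_le [Finite ι] (hμ : ∀ i, 0 < μ i) : ∃ c, 0 < c ∧ ∀ i, c ≤ μ i := by
  cases isEmpty_or_nonempty ι
  · exact ⟨1, one_pos, fun i => isEmptyElim i⟩
  · obtain ⟨i, hi⟩ := Finite.exists_min μ
    exact ⟨μ i, hμ i, hi⟩

/-- With positive definite process noise, the Kalman gains of the error covariance of stable gains
are stable. -/
lemma powersVanish_neg_gain (hQ : Q.PosSemidef) (hR : R.PosDef) (hP : ∀ i j, 0 ≤ P i j)
    (hμ : ∀ i, 0 < μ i) (hst : ∀ j, ∑ i, μ i * P i j = μ j) {ε : ℝ} (hε : 0 < ε)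
    {Y : ι → Matrix (Fin n) (Fin n) ℝ} (hY : AllPosSemidef Y) {L : ι → Matrix (Fin n) (Fin m) ℝ}
    (hYL : Y = jumpOperator P (fun i => A + L i * H i) Y + noiseTerm R P μ (Q + ε • 1) L) :
    PowersVanish (jumpOperator P fun i => A + (-gain A H R μ Y i) * H i) := by
  -- The part ε·1 of the noise contributes ε μ_j·1 ≥ εc·1 in mode j, so `Y` itself is a Lyapunov
  -- certificate with constant εc.
  obtain ⟨c, hc, hcμ⟩ := exists_pos_forall_le hμ
  refine powersVanish_of_sub_jumpOperator hP (mul_pos hε hc) hY fun j => ?_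
  have h := congrFun (hYL.trans (jumpOperator_add_noiseTerm_eq hR hμ hY L)) j
  simp only [Pi.add_apply] at h
  have hn := noiseTerm_sub (R := R) hst (Q + ε • 1) Q (fun i => -gain A H R μ Y i) j
  rw [add_sub_cancel_left] at hn
  have : Y j - jumpOperator P (fun i => A + (-gain A H R μ Y i) * H i) Y j
        - ((ε * c) • (1 : ι → Matrix (Fin n) (Fin n) ℝ)) j
      = noiseTerm R P μ Q (fun i => -gain A H R μ Y i) j + excess A H R P μ Y L j
        + (ε * (μ j - c)) • (1 : Matrix (Fin n) (Fin n) ℝ) := by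
    nth_rw 1 [h]
    rw [sub_eq_iff_eq_add.1 hn, mul_sub, sub_smul, smul_smul, mul_comm (μ j), Pi.smul_apply,
      Pi.one_apply]
    abel
  change (Y j - jumpOperator P (fun i => A + (-gain A H R μ Y i) * H i) Y j
    - ((ε * c) • (1 : ι → Matrix (Fin n) (Fin n) ℝ)) j).PosSemidef
  rw [this]
  exact ((allPosSemidef_noiseTerm hQ hR hP hμ _ j).add
    (allPosSemidef_excess hR hP hμ hY L j)).add
    (Matrix.PosSemidef.one.smul (mul_nonneg hε.le (sub_nonneg.2 (hcμ j))))

/-- Passing to the Kalman gains and decreasing the process noise decreases the error covariance. -/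
lemma allPosSemidef_sub_of_neg_gain {Q' : Matrix (Fin n) (Fin n) ℝ} (hQ : (Q - Q').PosSemidef)
    (hR : R.PosDef) (hP : ∀ i j, 0 ≤ P i j)
    (hμ : ∀ i, 0 < μ i) (hst : ∀ j, ∑ i, μ i * P i j = μ j)
    {Y Y' : ι → Matrix (Fin n) (Fin n) ℝ} (hY : AllPosSemidef Y)
    {L : ι → Matrix (Fin n) (Fin m) ℝ}
    (hYL : Y = jumpOperator P (fun i => A + L i * H i) Y + noiseTerm R P μ Q L)
    (hstab : PowersVanish (jumpOperator P fun i => A + (-gain A H R μ Y i) * H i))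
    (hY' : Y' = jumpOperator P (fun i => A + (-gain A H R μ Y i) * H i) Y'
      + noiseTerm R P μ Q' (fun i => -gain A H R μ Y i)) : AllPosSemidef (Y - Y') := by
  have hn : noiseTerm R P μ Q (fun i => -gain A H R μ Y i)
      - noiseTerm R P μ Q' (fun i => -gain A H R μ Y i) = fun j => μ j • (Q - Q') :=
    funext fun j => noiseTerm_sub hst _ _ _ j
  -- The difference of the two covariances solves a Lyapunov equation of the Kalman gains, driven by
  -- the noise decrease and the excess.
  refine allPosSemidef_of_eq_add hstab (fun V hV => allPosSemidef_jumpOperator hP _ hV)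
    (G := (fun j => μ j • (Q - Q')) + excess A H R P μ Y L)
    (AllPosSemidef.add (fun j => hQ.smul (hμ j).le) (allPosSemidef_excess hR hP hμ hY L)) ?_
  rw [map_sub, ← hn]
  nth_rw 1 [hYL, jumpOperator_add_noiseTerm_eq hR hμ hY L, hY']
  abel

omit [Fintype ι] in
/-- A decreasing sequence of tuples of positive semidefinite matrices converges. -/
lemma exists_tendsto_of_allPosSemidef_sub {Y : ℕ → ι → Matrix (Fin n) (Fin n) ℝ}
    (hY : ∀ k, AllPosSemidef (Y k)) (hanti : ∀ k, AllPosSemidef (Y k - Y (k + 1))) :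
    ∃ Y', Tendsto Y atTop (𝓝 Y') := by
  have hq (i : ι) (x : Fin n → ℝ) : ∃ l, Tendsto (fun k => x ⬝ᵥ Y k i *ᵥ x) atTop (𝓝 l) := by
    refine ⟨_, tendsto_atTop_ciInf (antitone_nat_of_succ_le fun k => ?_) ⟨0, ?_⟩⟩
    · have := (posSemidef_real_iff.1 (hanti k i)).2 x
      rw [Pi.sub_apply, Matrix.sub_mulVec, dotProduct_sub] at this
      linarith
    · rintro _ ⟨k, rfl⟩
      exact (posSemidef_real_iff.1 (hY k i)).2 x
  -- Polarization recovers the entries from the quadratic forms, which decrease and are bounded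
  -- below by 0.
  have hent (i : ι) (a b : Fin n) : ∃ l, Tendsto (fun k => Y k i a b) atTop (𝓝 l) := by
    obtain ⟨l, hl⟩ := hq i (Pi.single a 1 + Pi.single b 1)
    obtain ⟨l', hl'⟩ := hq i (Pi.single a 1 - Pi.single b 1)
    refine ⟨_, ((hl.sub hl').mul_const (1 / 4)).congr fun k => ?_⟩
    have hs : Y k i b a = Y k i a b :=
      congrFun (congrFun (posSemidef_real_iff.1 (hY k i)).1 a) b
    simp [Matrix.mulVec_add, Matrix.mulVec_sub, hs]
    ring
  choose l hl using hent
  exact ⟨fun i => Matrix.of (l i), tendsto_pi_nhds.2 fun i => tendsto_pi_nhds.2 fun a =>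
    tendsto_pi_nhds.2 fun b => hl i a b⟩

omit [Fintype ι] in
lemma continuousAt_gain (hR : R.PosDef) (hμ : ∀ i, 0 < μ i)
    {Y : ι → Matrix (Fin n) (Fin n) ℝ} (hY : AllPosSemidef Y) :
    ContinuousAt (fun Y => gain A H R μ Y) Y := by
  refine continuousAt_pi.2 fun i => ?_
  have hM : ContinuousAt (fun Y : ι → Matrix (Fin n) (Fin n) ℝ =>
      (H i * Y i * (H i)ᵀ + μ i • R)⁻¹) Y := by
    have h := (posDef_innovation (H := H) hR hμ hY i).det_pos.ne'
    have hinv : ContinuousAt (fun M : Matrix (Fin m) (Fin m) ℝ => M⁻¹)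
        (H i * Y i * (H i)ᵀ + μ i • R) := by
      refine continuousAt_matrix_inv _ ?_
      simpa only [Ring.inverse_eq_inv'] using continuousAt_inv₀ h
    refine ContinuousAt.comp (f := fun Y : ι → Matrix (Fin n) (Fin n) ℝ =>
      H i * Y i * (H i)ᵀ + μ i • R) hinv (Continuous.continuousAt ?_)
    fun_prop
  have h2 : Continuous fun z : Matrix (Fin n) (Fin n) ℝ × Matrix (Fin m) (Fin m) ℝ =>
      A * z.1 * (H i)ᵀ * z.2 := by fun_prop
  exact h2.continuousAt.comp (f := fun Y : ι → Matrix (Fin n) (Fin n) ℝ =>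
    (Y i, (H i * Y i * (H i)ᵀ + μ i • R)⁻¹)) ((continuous_apply i).continuousAt.prodMk hM)

/-- Mean-square detectability yields a positive semidefinite solution of the filtering coupled
algebraic Riccati equations whose error operator is a limit of stable ones. -/
lemma exists_solvesCARE (hQ : Q.PosSemidef) (hR : R.PosDef) (hP : ∀ i j, 0 ≤ P i j)
    (hμ : ∀ i, 0 < μ i) (hst : ∀ j, ∑ i, μ i * P i j = μ j)
    {L₀ : ι → Matrix (Fin n) (Fin m) ℝ}
    (hL₀ : PowersVanish (jumpOperator P fun i => A + L₀ i * H i)) :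
    ∃ Y, AllPosSemidef Y ∧ SolvesCARE A H Q R P μ Y ∧
      ∃ F : ℕ → ι → Matrix (Fin n) (Fin n) ℝ, (∀ k, PowersVanish (jumpOperator P (F k))) ∧
        Tendsto F atTop (𝓝 fun i => A + (-gain A H R μ Y i) * H i) := by
  -- The covariance is made a total function of the gains, with value 0 at unstable ones, so that
  -- the recursion can be written before its stability is proved.
  have hex (ε : ℝ) (L : ι → Matrix (Fin n) (Fin m) ℝ) : ∃ Y,
      PowersVanish (jumpOperator P fun i => A + L i * H i) →
      Y = jumpOperator P (fun i => A + L i * H i) Y + noiseTerm R P μ (Q + ε • 1) L := by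
    by_cases h : PowersVanish (jumpOperator P fun i => A + L i * H i)
    · obtain ⟨Y, hY⟩ := exists_eq_add h (noiseTerm R P μ (Q + ε • 1) L)
      exact ⟨Y, fun _ => hY⟩
    · exact ⟨0, fun h' => absurd h' h⟩
  choose cov hcov using hex
  let ε : ℕ → ℝ := fun k => 1 / ((k : ℝ) + 1)
  have hε (k : ℕ) : 0 < ε k := Nat.one_div_pos_of_nat
  -- The gains of stage k + 1 are the negative Kalman gains of the covariance of stage k, taken at
  -- noise level `ε k`.
  let L : ℕ → ι → Matrix (Fin n) (Fin m) ℝ := fun k =>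
    Nat.rec L₀ (fun k L i => -gain A H R μ (cov (ε k) L) i) k
  let Y : ℕ → ι → Matrix (Fin n) (Fin n) ℝ := fun k => cov (ε k) (L k)
  have hL (k : ℕ) : L (k + 1) = fun i => -gain A H R μ (Y k) i := rfl
  have hQε (k : ℕ) : (Q + ε k • 1).PosSemidef := hQ.add (Matrix.PosSemidef.one.smul (hε k).le)
  have hpsd (k : ℕ) (h : PowersVanish (jumpOperator P fun i => A + L k i * H i)) :
      AllPosSemidef (Y k) :=
    allPosSemidef_of_eq_add h (fun V hV => allPosSemidef_jumpOperator hP _ hV)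
      (allPosSemidef_noiseTerm (hQε k) hR hP hμ _) (hcov (ε k) (L k) h)
  have hstab (k : ℕ) : PowersVanish (jumpOperator P fun i => A + L k i * H i) := by
    induction k with
    | zero => exact hL₀
    | succ k ih => exact powersVanish_neg_gain hQ hR hP hμ hst (hε k) (hpsd k ih) (hcov _ _ ih)
  have hYpsd (k : ℕ) : AllPosSemidef (Y k) := hpsd k (hstab k)
  have hYeq (k : ℕ) : Y k = jumpOperator P (fun i => A + L k i * H i) (Y k)
      + noiseTerm R P μ (Q + ε k • 1) (L k) := hcov _ _ (hstab k)
  have hanti (k : ℕ) : AllPosSemidef (Y k - Y (k + 1)) := by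
    refine allPosSemidef_sub_of_neg_gain ?_ hR hP hμ hst (hYpsd k) (hYeq k) (hstab (k + 1))
      (hYeq (k + 1))
    rw [add_sub_add_left_eq_sub, ← sub_smul]
    refine Matrix.PosSemidef.one.smul (sub_nonneg.2 ?_)
    exact Nat.one_div_le_one_div k.le_succ
  obtain ⟨Y', hY'⟩ := exists_tendsto_of_allPosSemidef_sub hYpsd hanti
  have hY'psd : AllPosSemidef Y' := allPosSemidef_of_tendsto hYpsd hY'
  have hLlim : Tendsto (fun k => L (k + 1)) atTop (𝓝 fun i => -gain A H R μ Y' i) :=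
    ((continuousAt_gain hR hμ hY'psd).tendsto.comp hY').neg
  -- The index is shifted by one because `L 0` is the given `L₀`, not a Kalman gain.
  refine ⟨Y', hY'psd, (solvesCARE_iff hR hμ hY'psd).2 ?_,
    fun k i => A + L (k + 1) i * H i, fun k => hstab (k + 1), ?_⟩
  · have hc : Continuous fun z : (ι → Matrix (Fin n) (Fin m) ℝ) ×
        (ι → Matrix (Fin n) (Fin n) ℝ) × ℝ =>
        jumpOperator P (fun i => A + z.1 i * H i) z.2.1 + noiseTerm R P μ (Q + z.2.2 • 1) z.1 := by
      refine continuous_pi fun j => ?_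
      simp only [Pi.add_apply, jumpOperator_apply, noiseTerm]
      fun_prop
    have hε0 : Tendsto (fun k => ε (k + 1)) atTop (𝓝 0) :=
      tendsto_one_div_add_atTop_nhds_zero_nat.comp (tendsto_add_atTop_nat 1)
    have hY1 : Tendsto (fun k => Y (k + 1)) atTop (𝓝 Y') := hY'.comp (tendsto_add_atTop_nat 1)
    have h := (hc.tendsto (fun i => -gain A H R μ Y' i, Y', 0)).comp
      (hLlim.prodMk_nhds (hY1.prodMk_nhds hε0))
    simp only [zero_smul, add_zero] at h
    exact tendsto_nhds_unique hY1 (h.congr fun k => (hYeq (k + 1)).symm)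
  · have hc : Continuous fun (z : ι → Matrix (Fin n) (Fin m) ℝ) i => A + z i * H i := by fun_prop
    exact (hc.tendsto _).comp hLlim

end Riccati

/-! ### Unit-circle eigenvalues and invariant positive semidefinite matrices. -/

section UnitCircle

variable {n : ℕ}

lemma rank_eq_iff_vecMul {κ : Type*} [Fintype κ] (M : Matrix (Fin n) κ ℂ) :
    M.rank = n ↔ ∀ v, v ᵥ* M = 0 → v = 0 := by
  have h1 : LinearIndependent ℂ M.row ↔ ∀ v, v ᵥ* M = 0 → v = 0 := by
    rw [← Matrix.vecMul_injective_iff]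
    exact injective_iff_map_eq_zero (Matrix.vecMulLinear M)
  rw [← h1]
  constructor
  · intro h
    rw [linearIndependent_iff_card_eq_finrank_span, Set.finrank, ← Matrix.rank_eq_finrank_span_row,
      h, Fintype.card_fin]
  · intro h
    simpa using h.rank_matrix

/-- The rank condition expressed by left eigenvectors. -/
lemma forall_rank_fromCols_iff (A Q : Matrix (Fin n) (Fin n) ℝ) :
    (∀ z : ℂ, ‖z‖ = 1 →
        (Matrix.fromCols (z • (1 : Matrix (Fin n) (Fin n) ℂ) - A.map Complex.ofReal)
          (Q.map Complex.ofReal)).rank = n) ↔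
      ∀ (z : ℂ) (v : Fin n → ℂ), ‖z‖ = 1 → v ᵥ* A.map Complex.ofReal = z • v →
        v ᵥ* Q.map Complex.ofReal = 0 → v = 0 := by
  simp only [rank_eq_iff_vecMul, Matrix.vecMul_fromCols]
  refine forall_congr' fun z => ?_
  rw [forall_comm]
  refine forall_congr' fun v => forall_congr' fun _ => ?_
  rw [← and_imp]
  refine imp_congr_left ?_
  rw [← Sum.elim_zero_zero, Sum.elim_eq_iff, Matrix.vecMul_sub, Matrix.vecMul_smul,
    Matrix.vecMul_one, sub_eq_zero]
  exact and_congr_left' eq_comm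

/-- Let a and b be the real and imaginary parts of v. Since |z| = 1, `A` acts on the pair (a, b) as
a rotation, which leaves aaᵀ + bbᵀ unchanged. -/
lemma exists_posSemidef_of_vecMul_eq {A Q : Matrix (Fin n) (Fin n) ℝ} {z : ℂ} {v : Fin n → ℂ}
    (hz : ‖z‖ = 1) (hv : v ≠ 0) (hA : v ᵥ* A.map Complex.ofReal = z • v)
    (hQ : v ᵥ* Q.map Complex.ofReal = 0) :
    ∃ S : Matrix (Fin n) (Fin n) ℝ, S.PosSemidef ∧ S ≠ 0 ∧ Aᵀ * S * A = S ∧ S * Q = 0 := by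
  let a : Fin n → ℝ := fun i => (v i).re
  let b : Fin n → ℝ := fun i => (v i).im
  have hre (M : Matrix (Fin n) (Fin n) ℝ) (j : Fin n) :
      ((v ᵥ* M.map Complex.ofReal) j).re = (a ᵥ* M) j := by
    simp [Matrix.vecMul, dotProduct, a]
  have him (M : Matrix (Fin n) (Fin n) ℝ) (j : Fin n) :
      ((v ᵥ* M.map Complex.ofReal) j).im = (b ᵥ* M) j := by
    simp [Matrix.vecMul, dotProduct, b]
  have haA : a ᵥ* A = z.re • a - z.im • b := by
    funext j
    simp [← hre, hA, a, b]
  have hbA : b ᵥ* A = z.re • b + z.im • a := by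
    funext j
    simp [← him, hA, a, b]
  have haQ : a ᵥ* Q = 0 := by
    funext j
    simp [← hre, hQ]
  have hbQ : b ᵥ* Q = 0 := by
    funext j
    simp [← him, hQ]
  have hz2 : z.re * z.re + z.im * z.im = 1 := by
    rw [← Complex.normSq_apply, Complex.normSq_eq_norm_sq, hz, one_pow]
  refine ⟨Matrix.vecMulVec a a + Matrix.vecMulVec b b, ?_, ?_, ?_, ?_⟩
  · have h1 := (Matrix.posSemidef_vecMulVec_self_star a).add (Matrix.posSemidef_vecMulVec_self_star b)
    simpa using h1
  · intro h
    refine hv (funext fun i => ?_)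
    have h1 := congrFun (congrFun h i) i
    simp only [Matrix.add_apply, Matrix.vecMulVec_apply, Matrix.zero_apply] at h1
    have ha : a i = 0 := by nlinarith [mul_self_nonneg (a i), mul_self_nonneg (b i)]
    have hb : b i = 0 := by nlinarith [mul_self_nonneg (a i), mul_self_nonneg (b i)]
    exact Complex.ext ha hb
  · rw [Matrix.mul_add, Matrix.add_mul, Matrix.mul_vecMulVec, Matrix.mul_vecMulVec,
      Matrix.vecMulVec_mul, Matrix.vecMulVec_mul, Matrix.mulVec_transpose, Matrix.mulVec_transpose,
      haA, hbA]
    ext i j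
    simp only [Matrix.add_apply, Matrix.vecMulVec_apply, Pi.add_apply, Pi.sub_apply, Pi.smul_apply,
      smul_eq_mul]
    linear_combination (a i * a j + b i * b j) * hz2
  · rw [Matrix.add_mul, Matrix.vecMulVec_mul, Matrix.vecMulVec_mul, haQ, hbQ]
    simp

-- The form x*Sx is invariant under `A`, so `A` induces an isometry of the nonzero space ℂⁿ / ker S.
-- An eigenvector class x of it has an eigenvalue c of modulus one, and Sx is the required left
-- eigenvector of `A`.
open scoped ComplexOrder in
lemma exists_vecMul_eq_of_posSemidef {A Q S : Matrix (Fin n) (Fin n) ℝ}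
    (hS : S.PosSemidef) (hS0 : S ≠ 0) (hSA : Aᵀ * S * A = S) (hSQ : S * Q = 0) :
    ∃ (z : ℂ) (v : Fin n → ℂ), ‖z‖ = 1 ∧ v ≠ 0 ∧ v ᵥ* A.map Complex.ofReal = z • v ∧
      v ᵥ* Q.map Complex.ofReal = 0 := by
  set A' : Matrix (Fin n) (Fin n) ℂ := A.map Complex.ofReal
  set Q' : Matrix (Fin n) (Fin n) ℂ := Q.map Complex.ofReal
  set S' : Matrix (Fin n) (Fin n) ℂ := S.map Complex.ofReal
  have hmul (M N : Matrix (Fin n) (Fin n) ℝ) :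
      (M * N).map Complex.ofReal = M.map Complex.ofReal * N.map Complex.ofReal :=
    Matrix.map_mul (f := Complex.ofRealHom)
  have hconj (M : Matrix (Fin n) (Fin n) ℝ) :
      (M.map Complex.ofReal)ᴴ = Mᵀ.map Complex.ofReal := by
    ext i j
    simp
  have hS' : S'.PosSemidef := by
    obtain ⟨B, hB⟩ := exists_eq_transpose_mul_self hS
    have : S' = (B.map Complex.ofReal)ᴴ * B.map Complex.ofReal := by
      rw [hconj, ← hmul, ← hB]
    rw [this]
    exact Matrix.posSemidef_conjTranspose_mul_self _
  have hSA' : A'ᵀ * S' * A' = S' := by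
    change Aᵀ.map Complex.ofReal * S' * A' = S'
    rw [← hmul, ← hmul, hSA]
  have hSQ' : Q'ᵀ * S' = 0 := by
    change Qᵀ.map Complex.ofReal * S' = 0
    rw [← hmul, ← (posSemidef_real_iff.1 hS).1, ← Matrix.transpose_mul, hSQ]
    ext i j
    simp
  have hadj (u w : Fin n → ℂ) : star u ⬝ᵥ S' *ᵥ w = star (S' *ᵥ u) ⬝ᵥ w := by
    rw [Matrix.star_mulVec, hS'.isHermitian.eq, Matrix.dotProduct_mulVec]
  have hq (x : Fin n → ℂ) : star (A' *ᵥ x) ⬝ᵥ S' *ᵥ (A' *ᵥ x) = star x ⬝ᵥ S' *ᵥ x := by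
    have hA' : A'ᴴ = A'ᵀ := hconj A
    rw [Matrix.star_mulVec, hA', ← Matrix.dotProduct_mulVec, Matrix.mulVec_mulVec,
      Matrix.mulVec_mulVec, hSA']
  let K := LinearMap.ker (Matrix.mulVecLin S')
  have hK : K ≤ K.comap (Matrix.mulVecLin A') := by
    intro x hx
    have hx' : S' *ᵥ x = 0 := hx
    change S' *ᵥ (A' *ᵥ x) = 0
    rw [← hS'.dotProduct_mulVec_zero_iff, hq, hx', dotProduct_zero]
  have hne : K ≠ ⊤ := by
    intro h
    refine hS0 (Matrix.ext fun i j => ?_)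
    have h1 : S' *ᵥ Pi.single j 1 = 0 := (h ▸ Submodule.mem_top : Pi.single j 1 ∈ K)
    simpa [S'] using congrFun h1 i
  have : Nontrivial ((Fin n → ℂ) ⧸ K) := Submodule.Quotient.nontrivial_iff.2 hne
  obtain ⟨c, hc⟩ := Module.End.exists_eigenvalue (K.mapQ K (Matrix.mulVecLin A') hK)
  obtain ⟨w, hw⟩ := hc.exists_hasEigenvector
  obtain ⟨x, rfl⟩ := K.mkQ_surjective w
  have hx0 : S' *ᵥ x ≠ 0 := fun h =>
    hw.2 ((Submodule.Quotient.mk_eq_zero K).2 h)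
  have hx : S' *ᵥ (A' *ᵥ x) = c • S' *ᵥ x := by
    have h1 := hw.apply_eq_smul
    rw [Submodule.mkQ_apply, Submodule.mapQ_apply, ← Submodule.Quotient.mk_smul,
      Submodule.Quotient.eq] at h1
    have h2 : S' *ᵥ (A' *ᵥ x - c • x) = 0 := h1
    rwa [Matrix.mulVec_sub, Matrix.mulVec_smul, sub_eq_zero] at h2
  have hc1 : ‖c‖ = 1 := by
    have h1 := hq x
    rw [hx, dotProduct_smul, hadj, hx, star_smul, smul_dotProduct, ← hadj, smul_eq_mul,
      smul_eq_mul, ← mul_assoc] at h1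
    have h2 : star x ⬝ᵥ S' *ᵥ x ≠ 0 := fun h => hx0 ((hS'.dotProduct_mulVec_zero_iff x).1 h)
    have h3 : c * star c = 1 := mul_right_cancel₀ h2 (h1.trans (one_mul _).symm)
    have h4 : ‖c‖ * ‖c‖ = 1 := by simpa using congrArg norm h3
    nlinarith [norm_nonneg c]
  have hc0 : c ≠ 0 := by
    rintro rfl
    simp at hc1
  -- The eigenvalue is inverted: SAx = cSx together with AᵀSA = S gives Sx = cAᵀSx.
  refine ⟨c⁻¹, S' *ᵥ x, by simp [hc1], hx0, ?_, ?_⟩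
  · rw [eq_inv_smul_iff₀ hc0, ← Matrix.mulVec_transpose, ← Matrix.mulVec_smul, ← hx,
      Matrix.mulVec_mulVec, Matrix.mulVec_mulVec, hSA']
  · rw [← Matrix.mulVec_transpose, Matrix.mulVec_mulVec, hSQ', Matrix.zero_mulVec]

/-- `(A, Q)` has no uncontrollable eigenvalue on the unit circle if and only if no nonzero positive
semidefinite `S` annihilating `Q` is invariant under `A`. -/
lemma forall_rank_fromCols_iff_posSemidef (A Q : Matrix (Fin n) (Fin n) ℝ) :
    (∀ z : ℂ, ‖z‖ = 1 →
        (Matrix.fromCols (z • (1 : Matrix (Fin n) (Fin n) ℂ) - A.map Complex.ofReal)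
          (Q.map Complex.ofReal)).rank = n) ↔
      ∀ S : Matrix (Fin n) (Fin n) ℝ, S.PosSemidef → Aᵀ * S * A = S → S * Q = 0 → S = 0 := by
  rw [forall_rank_fromCols_iff]
  constructor
  · intro h S hS hSA hSQ
    by_contra hS0
    obtain ⟨z, v, hz, hv, hvA, hvQ⟩ := exists_vecMul_eq_of_posSemidef hS hS0 hSA hSQ
    exact hv (h z v hz hvA hvQ)
  · intro h z v hz hvA hvQ
    by_contra hv
    obtain ⟨S, hS, hS0, hSA, hSQ⟩ := exists_posSemidef_of_vecMul_eq hz hv hvA hvQ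
    exact hS0 (h S hS hSA hSQ)

end UnitCircle

/-! ### The equivalence for chains with positive transition probabilities. -/

section Characterization

variable {ι : Type*} [Fintype ι] {m n : ℕ} {A Q : Matrix (Fin n) (Fin n) ℝ}
  {H : ι → Matrix (Fin m) (Fin n) ℝ} {R : Matrix (Fin m) (Fin m) ℝ} {P : Matrix ι ι ℝ} {μ : ι → ℝ}

/-- A positive semidefinite fixed point of the adjoint of the error operator of a solution of the
coupled Riccati equations gives an invariant matrix that annihilates `Q`. -/
lemma exists_invariant_of_jumpAdjoint_eq (hQ : Q.PosSemidef) (hR : R.PosDef)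
    (hP : ∀ i j, 0 < P i j) (hμ : ∀ i, 0 < μ i) (hst : ∀ j, ∑ i, μ i * P i j = μ j)
    {L : ι → Matrix (Fin n) (Fin m) ℝ} {Y U : ι → Matrix (Fin n) (Fin n) ℝ}
    (hY : Y = jumpOperator P (fun i => A + L i * H i) Y + noiseTerm R P μ Q L)
    (hU : AllPosSemidef U) (hU0 : U ≠ 0) (hUeq : jumpAdjoint P (fun i => A + L i * H i) U = U) :
    ∃ S : Matrix (Fin n) (Fin n) ℝ, S.PosSemidef ∧ S ≠ 0 ∧ Aᵀ * S * A = S ∧ S * Q = 0 := by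
  -- Pairing the Lyapunov equation with a fixed point of the adjoint cancels `Y`.
  have h0 : tracePairing U (noiseTerm R P μ Q L) = 0 := by
    have h1 : tracePairing U Y = tracePairing U _ := congrArg _ hY
    rw [tracePairing_add_right, tracePairing_jumpOperator, hUeq] at h1
    linarith
  have hsum : ∑ j, ∑ i, P i j * (μ i * ((U j * (L i * R * (L i)ᵀ)).trace + (U j * Q).trace))
      = 0 := by
    rw [← h0]
    simp only [tracePairing, noiseTerm, Finset.mul_sum, Matrix.trace_sum, mul_smul_comm,
      Matrix.trace_smul, mul_add, Matrix.trace_add, smul_eq_mul]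
  have hLR (i j : ι) : 0 ≤ (U j * (L i * R * (L i)ᵀ)).trace :=
    trace_mul_nonneg (hU j) (posSemidef_mul_mul_transpose hR.posSemidef _)
  have hQU (j : ι) : 0 ≤ (U j * Q).trace := trace_mul_nonneg (hU j) hQ
  have hterm (i j : ι) : 0 ≤ P i j * (μ i * ((U j * (L i * R * (L i)ᵀ)).trace
      + (U j * Q).trace)) :=
    mul_nonneg (hP i j).le (mul_nonneg (hμ i).le (add_nonneg (hLR i j) (hQU j)))
  -- Strict positivity of `P i j` and `μ i` isolates every pair of modes, not only the diagonal
  -- ones.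
  have hz (i j : ι) : (U j * (L i * R * (L i)ᵀ)).trace + (U j * Q).trace = 0 := by
    have h1 := (Finset.sum_eq_zero_iff_of_nonneg fun j _ =>
      Finset.sum_nonneg fun i _ => hterm i j).1 hsum j (Finset.mem_univ j)
    have h2 := (Finset.sum_eq_zero_iff_of_nonneg fun i _ => hterm i j).1 h1 i (Finset.mem_univ i)
    rcases mul_eq_zero.1 h2 with h3 | h3
    · exact absurd h3 (hP i j).ne'
    · exact (mul_eq_zero.1 h3).resolve_left (hμ i).ne'
  have hUL (i j : ι) : U j * L i = 0 :=
    mul_eq_zero_of_trace_mul_posDef (hU j) hR (by linarith [hz i j, hLR i j, hQU j])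
  have hUQ (j : ι) : U j * Q = 0 :=
    mul_eq_zero_of_trace_mul (hU j) hQ (by linarith [hz j j, hLR j j, hQU j])
  have hLU (i j : ι) : (L i)ᵀ * U j = 0 := by
    rw [← (posSemidef_real_iff.1 (hU j)).1, ← Matrix.transpose_mul, hUL, Matrix.transpose_zero]
  have hconj (i j : ι) : (A + L i * H i)ᵀ * U j * (A + L i * H i) = Aᵀ * U j * A := by
    rw [Matrix.transpose_add, Matrix.transpose_mul, Matrix.add_mul, Matrix.mul_assoc (H i)ᵀ, hLU,
      Matrix.mul_zero, add_zero, Matrix.mul_add, ← Matrix.mul_assoc _ (L i),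
      Matrix.mul_assoc Aᵀ _ (L i), hUL, Matrix.mul_zero, Matrix.zero_mul, add_zero]
  -- Once the gains drop out, U_i = ∑_j p_ij AᵀU_jA; averaging with the stationary weights removes
  -- the transition matrix.
  refine ⟨∑ i, μ i • U i, Matrix.posSemidef_sum _ fun i _ => (hU i).smul (hμ i).le, ?_, ?_, ?_⟩
  · intro hS
    refine hU0 (funext fun i => ?_)
    have h1 : ∑ i, μ i * (U i).trace = 0 := by
      have := congrArg Matrix.trace hS
      simpa [Matrix.trace_sum] using this
    have h2 := (Finset.sum_eq_zero_iff_of_nonneg fun i _ =>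
      mul_nonneg (hμ i).le (hU i).trace_nonneg).1 h1 i (Finset.mem_univ i)
    exact (hU i).trace_eq_zero_iff.1 ((mul_eq_zero.1 h2).resolve_left (hμ i).ne')
  · have hUi (i : ι) : U i = ∑ j, P i j • (Aᵀ * U j * A) := by
      conv_lhs => rw [← hUeq]
      simp only [jumpAdjoint_apply, hconj]
    have hr : ∑ i, μ i • U i = ∑ i, ∑ j, (μ i * P i j) • (Aᵀ * U j * A) := by
      refine Finset.sum_congr rfl fun i _ => ?_
      conv_lhs => rw [hUi i]
      simp only [Finset.smul_sum, smul_smul]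
    conv_rhs => rw [hr, Finset.sum_comm]
    simp only [← Finset.sum_smul, hst, Finset.mul_sum, Finset.sum_mul, mul_smul_comm,
      smul_mul_assoc]
  · simp [Finset.sum_mul, hUQ]

/-- An invariant matrix that annihilates `Q` gives a fixed point of the adjoint of the error
operator of a solution of the coupled Riccati equations. -/
lemma jumpAdjoint_eq_of_invariant (hR : R.PosDef)
    (hrow : ∀ i, ∑ j, P i j = 1) (hμ : ∀ i, 0 < μ i)
    {Y : ι → Matrix (Fin n) (Fin n) ℝ} (hYpsd : AllPosSemidef Y) (hY : SolvesCARE A H Q R P μ Y)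
    {S : Matrix (Fin n) (Fin n) ℝ} (hS : S.PosSemidef) (hSA : Aᵀ * S * A = S) (hSQ : S * Q = 0) :
    jumpAdjoint P (fun i => A + (-gain A H R μ Y i) * H i) (fun _ => S) = fun _ => S := by
  have hM (i : ι) := posDef_innovation (H := H) hR hμ hYpsd i
  have hgain (i : ι) : A * Y i * (H i)ᵀ * (H i * Y i * (H i)ᵀ + μ i • R)⁻¹ * (H i * Y i * Aᵀ)
      = (A * Y i * (H i)ᵀ) * (H i * Y i * (H i)ᵀ + μ i • R)⁻¹ * (A * Y i * (H i)ᵀ)ᵀ := by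
    congr 1
    simp only [Matrix.transpose_mul, Matrix.transpose_transpose,
      (posSemidef_real_iff.1 (hYpsd i)).1, Matrix.mul_assoc]
  have htr (i : ι) : (S * (A * Y i * Aᵀ)).trace = (S * Y i).trace := by
    conv_rhs => rw [← hSA]
    rw [← Matrix.mul_assoc, Matrix.trace_mul_comm]
    simp only [Matrix.mul_assoc]
  have hnn (i : ι) : 0 ≤ (S * ((A * Y i * (H i)ᵀ) * (H i * Y i * (H i)ᵀ + μ i • R)⁻¹
      * (A * Y i * (H i)ᵀ)ᵀ)).trace :=
    trace_mul_nonneg hS (posSemidef_mul_mul_transpose (hM i).inv.posSemidef _)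
  have hj (j : ι) : (S * Y j).trace = ∑ i, P i j * ((S * Y i).trace
      - (S * ((A * Y i * (H i)ᵀ) * (H i * Y i * (H i)ᵀ + μ i • R)⁻¹
      * (A * Y i * (H i)ᵀ)ᵀ)).trace) := by
    conv_lhs => rw [hY j]
    simp only [hgain, Finset.mul_sum, Matrix.trace_sum, mul_smul_comm, Matrix.trace_smul, mul_add,
      mul_sub, hSQ, smul_zero, add_zero, Matrix.trace_sub, htr, smul_eq_mul]
  -- Summing over j with unit row sums makes the traces of `S * Y i` cancel, leaving only the
  -- nonnegative correction terms.
  have hsum : ∑ i, (S * ((A * Y i * (H i)ᵀ) * (H i * Y i * (H i)ᵀ + μ i • R)⁻¹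
      * (A * Y i * (H i)ᵀ)ᵀ)).trace = 0 := by
    have h1 := Finset.sum_congr (s₁ := Finset.univ) rfl fun j _ => hj j
    rw [Finset.sum_comm] at h1
    simp only [← Finset.sum_mul, hrow, one_mul, Finset.sum_sub_distrib] at h1
    linarith
  have hSK (i : ι) : S * gain A H R μ Y i = 0 := by
    have h1 := (Finset.sum_eq_zero_iff_of_nonneg fun i _ => hnn i).1 hsum i (Finset.mem_univ i)
    rw [gain, ← Matrix.mul_assoc, mul_eq_zero_of_trace_mul_posDef hS (hM i).inv h1, Matrix.zero_mul]
  have hKS (i : ι) : (gain A H R μ Y i)ᵀ * S = 0 := by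
    rw [← (posSemidef_real_iff.1 hS).1, ← Matrix.transpose_mul, hSK, Matrix.transpose_zero]
  funext i
  have hF : (A + (-gain A H R μ Y i) * H i)ᵀ * S * (A + (-gain A H R μ Y i) * H i) = S := by
    rw [Matrix.transpose_add, Matrix.transpose_mul, Matrix.add_mul, Matrix.mul_assoc (H i)ᵀ,
      Matrix.transpose_neg, Matrix.neg_mul, hKS, neg_zero,
      Matrix.mul_zero, add_zero, Matrix.mul_add, ← Matrix.mul_assoc _ (-_),
      Matrix.mul_assoc Aᵀ _ (-_), Matrix.mul_neg, hSK, neg_zero, Matrix.mul_zero, Matrix.zero_mul,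
      add_zero, hSA]
  rw [jumpAdjoint_apply]
  simp only [hF, ← Finset.sum_smul, hrow, one_smul]

/-- Existence of a mean-square stabilizing solution for a mode chain with positive transition
probabilities. -/
theorem exists_isMSStabilizingSolution_iff (hQ : Q.PosSemidef) (hR : R.PosDef)
    (hP : ∀ i j, 0 < P i j) (hrow : ∀ i, ∑ j, P i j = 1) (hμ : ∀ i, 0 < μ i)
    (hst : ∀ j, ∑ i, μ i * P i j = μ j) [Nonempty ι] :
    (∃ Y, IsMSStabilizingSolution A H Q R P μ Y) ↔
      (IsMSDetectable H (fun _ => A) P ∧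
        ∀ z : ℂ, ‖z‖ = 1 →
          (Matrix.fromCols (z • (1 : Matrix (Fin n) (Fin n) ℂ) - A.map Complex.ofReal)
            (Q.map Complex.ofReal)).rank = n) := by
  rw [forall_rank_fromCols_iff_posSemidef]
  have hP' (i j : ι) : 0 ≤ P i j := (hP i j).le
  constructor
  · rintro ⟨Y, hYpsd, hY, hstab⟩
    refine ⟨⟨fun i => -gain A H R μ Y i, hstab⟩, fun S hS hSA hSQ => ?_⟩
    have h := eq_zero_of_jumpAdjoint_eq ((spectralRad_lt_one_iff _).1 hstab)
      (jumpAdjoint_eq_of_invariant hR hrow hμ hYpsd hY hS hSA hSQ)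
    exact congrFun h (Classical.arbitrary ι)
  · rintro ⟨⟨L, hL⟩, hinv⟩
    obtain ⟨Y, hYpsd, hY, F, hF, hlim⟩ :=
      exists_solvesCARE hQ hR hP' hμ hst ((spectralRad_lt_one_iff _).1 hL)
    refine ⟨Y, hYpsd, hY, (spectralRad_lt_one_iff _).2 ?_⟩
    rcases powersVanish_or_exists_jumpAdjoint_eq hP' hF hlim with h | ⟨U, hU, hU0, hUeq⟩
    · exact h
    · obtain ⟨S, hS, hS0, hSA, hSQ⟩ := exists_invariant_of_jumpAdjoint_eq hQ hR hP hμ hst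
        ((solvesCARE_iff hR hμ hYpsd).1 hY) hU hU0 hUeq
      exact absurd (hinv S hS hSA hSQ) hS0

end Characterization

/-! ### Positivity and stationarity of the packet-drop chain. -/

section ModeChain

variable {m : ℕ} {p q : Fin m → ℝ}

/-- Binary digits identify modes with digit vectors, so sums over modes factor and row sums and
stationarity reduce to single two-state channels. -/
lemma sum_prod_arrival (f : Fin m → Fin 2 → ℝ) :
    ∑ θ : Fin (2 ^ m), ∏ l, f l (arrival θ l) = ∏ l, ∑ s, f l s := by
  rw [Finset.prod_univ_sum, Fintype.piFinset_univ]
  exact Equiv.sum_comp finFunctionFinEquiv.symm fun γ : Fin m → Fin 2 => ∏ l, f l (γ l)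

lemma modeTPM_pos (hp : ∀ l, 0 < p l ∧ p l < 1) (hq : ∀ l, 0 < q l ∧ q l < 1)
    (i j : Fin (2 ^ m)) : 0 < modeTPM p q i j := by
  simp only [modeTPM, Matrix.of_apply]
  refine Finset.prod_pos fun l _ => ?_
  generalize arrival i l = a
  generalize arrival j l = b
  fin_cases a <;> fin_cases b <;> simp [channelTPM, hp l, hq l]

lemma modeDist_pos (hp : ∀ l, 0 < p l ∧ p l < 1) (hq : ∀ l, 0 < q l ∧ q l < 1)
    (i : Fin (2 ^ m)) : 0 < modeDist p q i := by
  refine Finset.prod_pos fun l _ => ?_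
  have := (hp l).1
  have := (hq l).1
  generalize arrival i l = a
  fin_cases a <;> simp [channelDist] <;> positivity

lemma sum_modeTPM (p q : Fin m → ℝ) (i : Fin (2 ^ m)) : ∑ j, modeTPM p q i j = 1 := by
  simp only [modeTPM, Matrix.of_apply]
  rw [sum_prod_arrival fun l s => channelTPM (p l) (q l) (arrival i l) s]
  refine Finset.prod_eq_one fun l _ => ?_
  generalize arrival i l = a
  fin_cases a <;> simp [channelTPM]

lemma sum_modeDist_mul_modeTPM (hp : ∀ l, 0 < p l ∧ p l < 1) (hq : ∀ l, 0 < q l ∧ q l < 1)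
    (j : Fin (2 ^ m)) : ∑ i, modeDist p q i * modeTPM p q i j = modeDist p q j := by
  simp only [modeTPM, modeDist, Matrix.of_apply, ← Finset.prod_mul_distrib]
  rw [sum_prod_arrival fun l s =>
    channelDist (p l) (q l) s * channelTPM (p l) (q l) s (arrival j l)]
  refine Finset.prod_congr rfl fun l _ => ?_
  have hpq : p l + q l ≠ 0 := (add_pos (hp l).1 (hq l).1).ne'
  generalize arrival j l = b
  fin_cases b <;> simp [channelTPM, channelDist] <;> field_simp <;> ring

end ModeChain

end JumpFilter

end

theorem theorem4 {m n : ℕ}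
    (A : Matrix (Fin n) (Fin n) ℝ) (C : Matrix (Fin m) (Fin n) ℝ)
    (Q : Matrix (Fin n) (Fin n) ℝ) (hQ : Q.PosSemidef)
    (R : Matrix (Fin m) (Fin m) ℝ) (hR : R.PosDef)
    (p q : Fin m → ℝ) (hp : ∀ l, 0 < p l ∧ p l < 1) (hq : ∀ l, 0 < q l ∧ q l < 1) :
    (∃ Y : Fin (2 ^ m) → Matrix (Fin n) (Fin n) ℝ,
      JumpFilter.IsMSStabilizingSolution A (JumpFilter.modeOutput C) Q R
        (JumpFilter.modeTPM p q) (JumpFilter.modeDist p q) Y) ↔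
    (JumpFilter.IsMSDetectable (JumpFilter.modeOutput C) (fun _ => A) (JumpFilter.modeTPM p q) ∧
      ∀ z : ℂ, ‖z‖ = 1 →
        (Matrix.fromCols (z • (1 : Matrix (Fin n) (Fin n) ℂ) - A.map Complex.ofReal)
          (Q.map Complex.ofReal)).rank = n) :=
  JumpFilter.exists_isMSStabilizingSolution_iff hQ hR (JumpFilter.modeTPM_pos hp hq)
    (JumpFilter.sum_modeTPM p q) (JumpFilter.modeDist_pos hp hq)
    (JumpFilter.sum_modeDist_mul_modeTPM hp hq)
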